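/- Let $(W,\mathcal S)$ be a finite Coxeter system with Coxeter matrix $(m(s,t))_{s,t\in\mathcal S}$ and Coxeter length $\ell$. Let $B(W)$ be its Artin group, that is, the group generated by (a formal copy of) $\mathcal S$ subject only to the braid relations $sts\cdots = tst\cdots$ ($m(s,t)$ letters on each side) for $s\ne t$ in $\mathcal S$, and let the positive Artin monoid $B^+=B^+(W)$ be the submonoid of $B(W)$ generated by $\mathcal S$. For $w\in B^+$ let $\ell(w)$ be the length of a shortest expression of $w$ as a product of elements of $\mathcal S$. The (right) weak order on $B^+$ is the partial order in which $u\le w$ if there is $v\in B^+$ with $uv=w$ and $\ell(u)+\ell(v)=\ell(w)$. Let $w_\circ\in W$ be the longest element, and write $w_\circ$ also for the element of $B^+$ represented by a reduced word of it. For $u=s_1s_2\cdots s_p\in B^+$ with all $s_i\in\mathcal S$, put $\mathrm{rev}(u)=s_p\cdots s_2s_1$. Then for every integer $m\ge 0$ the $m$-weak order, i.e. the interval $[e,w_\circ^m]$ in the weak order on $B^+$ (with $e$ the identity), is a finite lattice. It is graded by the length $\ell$, with $\ell(e)=0$ and $\ell(w_\circ^m)=m\,\ell(w_\circ)$. It is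 rank-symmetric: for all integers $k,l\ge 0$ with $k+l=m\,\ell(w_\circ)$, the number of elements of length $k$ in the interval equals the number of elements of length $l$. It is self-dual: for every $w\in[e,w_\circ^m]$ the element $w_\circ^m w^{-1}$ of $B(W)$ lies in $B^+$, and $w\mapsto \mathrm{rev}(w_\circ^m w^{-1})$ is an order-reversing bijection of $[e,w_\circ^m]$ onto itself whose inverse is also order-reversing. -/

import Mathlib

namespace Artin

variable {B W : Type*} [Group W]

/-- The braid relator attached to two generators `i, j`: the quotient of the two alternating words
in `i, j` of length `M i j`. It is trivial for `i = j`, and for `M i j = 0` (which encodes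
`m(i, j) = ∞`). -/
def braidRelator (M : CoxeterMatrix B) (i j : B) : FreeGroup B :=
  ((CoxeterSystem.braidWord M i j).map FreeGroup.of).prod *
    ((CoxeterSystem.braidWord M j i).map FreeGroup.of).prod⁻¹

/-- The Artin group of a Coxeter matrix: generators `B`, subject to the braid relations only. -/
abbrev ArtinGroup (M : CoxeterMatrix B) : Type _ :=
  PresentedGroup (Set.range fun p : B × B => braidRelator M p.1 p.2)

/-- The generators of the Artin group. -/
def gen (M : CoxeterMatrix B) (i : B) : ArtinGroup M := PresentedGroup.of i

/-- The positive Artin monoid: the submonoid of the Artin group generated by the generators. -/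
def positiveSubmonoid (M : CoxeterMatrix B) : Submonoid (ArtinGroup M) :=
  Submonoid.closure (Set.range (gen M))

/-- The positive Artin monoid as a type. -/
abbrev ArtinMonoid (M : CoxeterMatrix B) : Type _ := ↥(positiveSubmonoid M)

/-- The generators of the positive Artin monoid. -/
def posGen (M : CoxeterMatrix B) (i : B) : ArtinMonoid M :=
  ⟨gen M i, Submonoid.subset_closure ⟨i, rfl⟩⟩

/-- The element of the positive Artin monoid represented by a word in the generators. -/
def word (M : CoxeterMatrix B) (ω : List B) : ArtinMonoid M := (ω.map (posGen M)).prod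

theorem word_nil (M : CoxeterMatrix B) : word M [] = 1 := rfl

theorem word_append (M : CoxeterMatrix B) (ω ω' : List B) :
    word M (ω ++ ω') = word M ω * word M ω' := by
  simp [word]

theorem word_surjective (M : CoxeterMatrix B) : Function.Surjective (word M) := by
  rintro ⟨x, hx⟩
  suffices h : ∃ ω, (word M ω : ArtinGroup M) = x by
    obtain ⟨ω, h⟩ := h
    exact ⟨ω, Subtype.ext h⟩
  induction hx using Submonoid.closure_induction with
  | mem x hx =>
    obtain ⟨i, rfl⟩ := hx
    exact ⟨[i], by simp [word, posGen]⟩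
  | one => exact ⟨[], rfl⟩
  | mul x y _ _ hx hy =>
    obtain ⟨ω, rfl⟩ := hx
    obtain ⟨ω', rfl⟩ := hy
    exact ⟨ω ++ ω', by rw [word_append]; rfl⟩

/-- The length of an element of the positive Artin monoid: the length of a shortest expression as
a product of generators. -/
noncomputable def length {M : CoxeterMatrix B} (w : ArtinMonoid M) : ℕ :=
  sInf {n | ∃ ω : List B, ω.length = n ∧ word M ω = w}

theorem exists_word_length_eq {M : CoxeterMatrix B} (w : ArtinMonoid M) :
    ∃ ω : List B, ω.length = length w ∧ word M ω = w := by
  obtain ⟨ω, h⟩ := word_surjective M w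
  exact Nat.sInf_mem (s := {n | ∃ ω : List B, ω.length = n ∧ word M ω = w}) ⟨_, ω, rfl, h⟩

theorem length_word_le {M : CoxeterMatrix B} (ω : List B) : length (word M ω) ≤ ω.length :=
  Nat.sInf_le ⟨ω, rfl, rfl⟩

theorem length_one {M : CoxeterMatrix B} : length (1 : ArtinMonoid M) = 0 :=
  Nat.le_zero.1 (length_word_le (M := M) [])

theorem eq_one_of_length_eq_zero {M : CoxeterMatrix B} {w : ArtinMonoid M} (h : length w = 0) :
    w = 1 := by
  obtain ⟨ω, h1, rfl⟩ := exists_word_length_eq w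
  rw [h] at h1
  rw [List.eq_nil_of_length_eq_zero h1, word_nil]

theorem length_mul_le {M : CoxeterMatrix B} (u v : ArtinMonoid M) :
    length (u * v) ≤ length u + length v := by
  obtain ⟨ω, h1, h2⟩ := exists_word_length_eq u
  obtain ⟨ω', h1', h2'⟩ := exists_word_length_eq v
  rw [← h1, ← h1', ← List.length_append]
  conv_lhs => rw [← h2, ← h2', ← word_append]
  exact length_word_le _

/-- The (right) weak order on the positive Artin monoid: `u ≤ w` if `w = u v` for some `v` in the
monoid with `ℓ(u) + ℓ(v) = ℓ(w)`. -/
instance weakOrder (M : CoxeterMatrix B) : PartialOrder (ArtinMonoid M) where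
  le u w := ∃ v : ArtinMonoid M, u * v = w ∧ length u + length v = length w
  le_refl u := ⟨1, mul_one u, by rw [length_one, add_zero]⟩
  le_trans := by
    rintro u w x ⟨v, rfl, h⟩ ⟨v', rfl, h'⟩
    refine ⟨v * v', (mul_assoc _ _ _).symm, ?_⟩
    have h1 := length_mul_le v v'
    have h2 := length_mul_le u (v * v')
    rw [← mul_assoc] at h2
    omega
  le_antisymm := by
    rintro u w ⟨v, rfl, h⟩ ⟨v', _, h'⟩
    have hv : v = 1 := eq_one_of_length_eq_zero (by omega)
    rw [hv, mul_one]

theorem prod_map_braidWord_eq (M : CoxeterMatrix B) (i j : B) :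
    ((CoxeterSystem.braidWord M i j).map (gen M)).prod =
      ((CoxeterSystem.braidWord M j i).map (gen M)).prod := by
  have h : PresentedGroup.mk (Set.range fun p : B × B => braidRelator M p.1 p.2)
      (braidRelator M i j) = 1 :=
    PresentedGroup.one_of_mem ⟨(i, j), rfl⟩
  rw [braidRelator, map_mul, map_inv, mul_inv_eq_one, map_list_prod, map_list_prod,
    List.map_map, List.map_map] at h
  exact h

theorem reverse_alternatingWord (i j : B) (p : ℕ) :
    (CoxeterSystem.alternatingWord i j p).reverse =
      if Even p then CoxeterSystem.alternatingWord j i p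
      else CoxeterSystem.alternatingWord i j p := by
  induction p generalizing i j with
  | zero => simp [CoxeterSystem.alternatingWord]
  | succ p ih =>
    rw [CoxeterSystem.alternatingWord_succ, List.concat_eq_append, List.reverse_append, ih]
    rw [CoxeterSystem.alternatingWord_succ', ← List.concat_eq_append,
      ← CoxeterSystem.alternatingWord_succ, CoxeterSystem.alternatingWord_succ']
    by_cases h : Even p <;> simp [h, Nat.even_add_one]

theorem prod_map_op_gen (M : CoxeterMatrix B) (ω : List B) :
    (ω.map fun i => MulOpposite.op (gen M i)).prod =
      MulOpposite.op (ω.reverse.map (gen M)).prod := by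
  induction ω with
  | nil => simp
  | cons i ω ih => simp [ih]

theorem prod_map_reverse_braidWord_eq (M : CoxeterMatrix B) (i j : B) :
    ((CoxeterSystem.braidWord M i j).reverse.map (gen M)).prod =
      ((CoxeterSystem.braidWord M j i).reverse.map (gen M)).prod := by
  have h := prod_map_braidWord_eq M i j
  rw [CoxeterSystem.braidWord, CoxeterSystem.braidWord, M.symmetric j i] at h
  rw [CoxeterSystem.braidWord, CoxeterSystem.braidWord, M.symmetric j i,
    reverse_alternatingWord, reverse_alternatingWord]
  split_ifs
  · exact h.symm
  · exact h

/-- The anti-automorphism of the Artin group that fixes all the generators. -/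
def revHom (M : CoxeterMatrix B) : ArtinGroup M →* (ArtinGroup M)ᵐᵒᵖ :=
  PresentedGroup.toGroup (f := fun i => MulOpposite.op (gen M i)) (by
    rintro _ ⟨⟨i, j⟩, rfl⟩
    simp only [braidRelator, map_mul, map_inv, mul_inv_eq_one, map_list_prod, List.map_map]
    have h : (FreeGroup.lift fun i => MulOpposite.op (gen M i)) ∘ FreeGroup.of =
        fun i => MulOpposite.op (gen M i) := by
      funext k
      simp
    rw [h, prod_map_op_gen, prod_map_op_gen, prod_map_reverse_braidWord_eq])

theorem revHom_word (M : CoxeterMatrix B) (ω : List B) :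
    (revHom M (word M ω : ArtinGroup M)).unop = (word M ω.reverse : ArtinGroup M) := by
  induction ω with
  | nil => simp [word]
  | cons i ω ih =>
    have h1 : word M (i :: ω) = word M [i] * word M ω := word_append M [i] ω
    have h2 : (revHom M (word M [i] : ArtinGroup M)).unop = (word M [i] : ArtinGroup M) := by
      have : (word M [i] : ArtinGroup M) = PresentedGroup.of i := by simp [word, posGen, gen]
      rw [this, revHom, PresentedGroup.toGroup.of]
      rfl
    rw [h1, List.reverse_cons, word_append, Submonoid.coe_mul, map_mul, MulOpposite.unop_mul, ih,
      h2, Submonoid.coe_mul]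

/-- The reverse map on the positive Artin monoid, sending `s₁ s₂ ⋯ sₚ` to `sₚ ⋯ s₂ s₁`
(see `rev_word`). -/
def rev {M : CoxeterMatrix B} (w : ArtinMonoid M) : ArtinMonoid M :=
  ⟨(revHom M (w : ArtinGroup M)).unop, by
    obtain ⟨ω, rfl⟩ := word_surjective M w
    rw [revHom_word]
    exact (word M ω.reverse).2⟩

theorem rev_word (M : CoxeterMatrix B) (ω : List B) : rev (word M ω) = word M ω.reverse :=
  Subtype.ext (revHom_word M ω)

/-- The longest element `w∘` of a finite Coxeter group: an element of maximal Coxeter length. -/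
noncomputable def longestElement [Finite W] {M : CoxeterMatrix B} (cs : CoxeterSystem M W) : W :=
  (Finite.exists_max cs.length).choose

/-- The element of the positive Artin monoid represented by a reduced word of `w`. -/
noncomputable def posLift {M : CoxeterMatrix B} (cs : CoxeterSystem M W) (w : W) : ArtinMonoid M :=
  word M (cs.exists_isReduced w).choose

/-- The fundamental element: the longest element `w∘`, seen in the positive Artin monoid. -/
noncomputable def fundamental [Finite W] {M : CoxeterMatrix B} (cs : CoxeterSystem M W) :
    ArtinMonoid M :=
  posLift cs (longestElement cs)

/-- The `m`-weak order: the interval from `1` to `w∘ ^ m` in the weak order of the positive Artin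
monoid, with the induced order. -/
abbrev MWeak [Finite W] {M : CoxeterMatrix B} (cs : CoxeterSystem M W) (m : ℕ) : Type _ :=
  ↥(Set.Icc (1 : ArtinMonoid M) (fundamental cs ^ m))

end Artin

/-! The braid relations are homogeneous, so the length on `B^+` is additive and the weak order is
plain left divisibility. Grading and finiteness follow at once. Meets and duality rest on two facts:
the monoid presented by the braid relations is left cancellative and embeds in the Artin group, and
a common right multiple of two generators is a right multiple of their braid word.

The input from Coxeter groups is positivity of roots in the geometric representation
(`geomRep_single_nonneg`). It shows that an element minimal in a coset of a rank two parabolic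
subgroup multiplies length-additively with alternating words (`length_mul_alternatingWord`). This
yields Matsumoto's theorem, hence a lift of `W` to the presented monoid that is multiplicative on
length-additive products.

The presented monoid acts on pairs (head in `W`, tail in the monoid), a pair representing lift(head)
* tail. Multiplying by `x` keeps the greatest part `v` of the head for which `x * v` is
length-additive and pushes the rest into the tail; `maxAdd_mul` makes this compatible with products.
Acting on `(1, 1)` recovers the element, which gives cancellation, and the head exhibits left
descents, which gives the statement on common multiples.

Conjugation by `Δ`, the lift of the longest element, permutes the generators, so `Δ²` is central.
Every generator divides `Δ`, so inverting `Δ²` makes all generators invertible, and cancellation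
makes the localization faithful; the universal property of the Artin group then gives the embedding.

Greatest common divisors come from local confluence: two steps by generators inside a set of common
divisors are completed by the braid word. Left and right divisors of `Δ^m` coincide, so taking
complements and reversing is an order-reversing involution, and it turns meets into joins. -/

namespace CoxeterSystem

open Finsupp

variable {B W : Type*} [Group W] {M : CoxeterMatrix B}

/-! ### The geometric representation -/

/-- The linear functional `v ↦ 2 ⟨e i, v⟩` of the geometric representation. If `M i j = 0`, the
division `π / 0 = 0` gives the value `-2` at `e j`, as it should be for `m(i, j) = ∞`. -/
noncomputable def rootFunctional (M : CoxeterMatrix B) (i : B) : (B →₀ ℝ) →ₗ[ℝ] ℝ :=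
  Finsupp.lift ℝ ℝ B fun j => -(2 * Real.cos (Real.pi / M i j))

theorem rootFunctional_single (i j : B) :
    rootFunctional M i (single j 1) = -(2 * Real.cos (Real.pi / M i j)) := by
  simp [rootFunctional]

theorem rootFunctional_single_self (i : B) : rootFunctional M i (single i 1) = 2 := by
  simp [rootFunctional_single]

/-- The reflection of the geometric representation attached to `i`. -/
noncomputable def geomReflection (M : CoxeterMatrix B) (i : B) : Module.End ℝ (B →₀ ℝ) :=
  LinearMap.id - (rootFunctional M i).smulRight (single i 1)

theorem geomReflection_apply (i : B) (v : B →₀ ℝ) :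
    geomReflection M i v = v - rootFunctional M i v • single i 1 := rfl

theorem geomReflection_mul_self (i : B) : geomReflection M i * geomReflection M i = 1 := by
  ext1 j
  ext1
  simp only [LinearMap.comp_apply, Module.End.mul_apply, geomReflection_apply, map_sub, map_smul,
    rootFunctional_single_self, lsingle_apply, Module.End.one_apply]
  module

theorem geomReflection_left (i j : B) (x y : ℝ) :
    geomReflection M i (x • single i 1 + y • single j 1) =
      (2 * Real.cos (Real.pi / M i j) * y - x) • single i 1 + y • single j 1 := by
  simp only [geomReflection_apply, map_add, map_smul, rootFunctional_single_self,
    rootFunctional_single]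
  module

theorem geomReflection_right (i j : B) (x y : ℝ) :
    geomReflection M j (x • single i 1 + y • single j 1) =
      x • single i 1 + (2 * Real.cos (Real.pi / M i j) * x - y) • single j 1 := by
  simp only [geomReflection_apply, map_add, map_smul, rootFunctional_single_self,
    rootFunctional_single, M.symmetric j i]
  module

/-- On the plane of the two basis vectors the product of the reflections acts as a rotation by `2π /
M i j`. In sine coordinates it just shifts the parameter `θ`, so powers are explicit. -/
theorem geomReflection_mul_pow_sin (i j : B) (n : ℕ) (θ : ℝ) :
    ((geomReflection M i * geomReflection M j) ^ n)
        (Real.sin (θ + Real.pi / M i j) • single i 1 + Real.sin θ • single j 1) =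
      Real.sin (θ + 2 * n * (Real.pi / M i j) + Real.pi / M i j) • single i 1 +
        Real.sin (θ + 2 * n * (Real.pi / M i j)) • single j 1 := by
  induction n with
  | zero => simp
  | succ n ih =>
    rw [pow_succ', Module.End.mul_apply, ih, Module.End.mul_apply, geomReflection_right,
      geomReflection_left]
    set φ := Real.pi / M i j
    have key : ∀ a : ℝ, 2 * Real.cos φ * Real.sin (a + φ) - Real.sin a = Real.sin (a + 2 * φ) := by
      intro a
      have h1 : Real.sin a = Real.sin (a + φ - φ) := by ring_nf
      have h2 : Real.sin (a + 2 * φ) = Real.sin (a + φ + φ) := by ring_nf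
      rw [h1, h2, Real.sin_sub, Real.sin_add (a + φ)]
      ring
    have e1 : θ + 2 * ((n + 1 : ℕ) : ℝ) * φ = θ + 2 * n * φ + 2 * φ := by push_cast; ring
    rw [key, e1]
    have := key (θ + 2 * n * φ + φ)
    rw [show θ + 2 * n * φ + φ + φ = θ + 2 * n * φ + 2 * φ by ring,
      show θ + 2 * n * φ + φ + 2 * φ = θ + 2 * n * φ + 2 * φ + φ by ring] at this
    rw [this]

theorem two_le_of_ne {i j : B} (hij : i ≠ j) (hM : M i j ≠ 0) : 2 ≤ M i j := by
  have := M.off_diagonal i j hij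
  omega

theorem sin_pi_div_pos {m : ℕ} (hm : 2 ≤ m) : 0 < Real.sin (Real.pi / m) := by
  have h : (2 : ℝ) ≤ m := by exact_mod_cast hm
  apply Real.sin_pos_of_pos_of_lt_pi
  · have := Real.pi_pos; positivity
  · rw [div_lt_iff₀ (by linarith)]
    nlinarith [Real.pi_pos]

theorem geomReflection_mul_pow_eq_one {i j : B} (hij : i ≠ j) :
    (geomReflection M i * geomReflection M j) ^ M i j = 1 := by
  by_cases hM : M i j = 0
  · rw [hM, pow_zero]
  have hs := sin_pi_div_pos (two_le_of_ne hij hM)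
  have h2π : 2 * ((M i j : ℕ) : ℝ) * (Real.pi / M i j) = 2 * Real.pi := by
    field_simp
  have key := fun θ => geomReflection_mul_pow_sin (M := M) i j (M i j) θ
  simp only [h2π] at key
  set T := (geomReflection M i * geomReflection M j) ^ M i j with hT
  set φ := Real.pi / M i j with hφ
  have hp : ∀ θ, T (Real.sin (θ + φ) • single i 1 + Real.sin θ • single j 1) =
      Real.sin (θ + φ) • single i 1 + Real.sin θ • single j 1 := by
    intro θ
    rw [key, show θ + 2 * Real.pi + φ = θ + φ + 2 * Real.pi by ring, Real.sin_add_two_pi,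
      Real.sin_add_two_pi]
  -- The parameters `0` and `-φ` each kill one of the two coordinates.
  have hi : T (single i 1) = single i 1 := by
    have := hp 0
    simp only [zero_add, Real.sin_zero, zero_smul, add_zero, map_smul] at this
    exact smul_right_injective _ hs.ne' this
  have hj : T (single j 1) = single j 1 := by
    have := hp (-φ)
    simp only [neg_add_cancel, Real.sin_zero, zero_smul, zero_add, map_smul, Real.sin_neg] at this
    exact smul_right_injective _ (neg_ne_zero.2 hs.ne') this
  -- This is the determinant of the linear system for `x` and `y` below: any `z` is a vector of the
  -- plane plus a vector killed by both functionals, which both reflections fix.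
  have hdet : 4 - (2 * Real.cos φ) ^ 2 ≠ 0 := by
    have := Real.sin_sq_add_cos_sq φ
    have h4 : 4 - (2 * Real.cos φ) ^ 2 = 4 * Real.sin φ ^ 2 := by nlinarith
    rw [h4]
    positivity
  refine LinearMap.ext fun z => ?_
  set p := rootFunctional M i z
  set q := rootFunctional M j z
  set c := 2 * Real.cos φ with hc
  set x := (2 * p + c * q) / (4 - c ^ 2) with hx
  set y := (c * p + 2 * q) / (4 - c ^ 2) with hy
  have h1 : rootFunctional M i (z - (x • single i 1 + y • single j 1)) = 0 := by
    simp only [map_sub, map_add, map_smul, rootFunctional_single_self, rootFunctional_single,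
      smul_eq_mul]
    change p - (x * 2 + y * -c) = 0
    rw [hx, hy]
    field_simp
    ring
  have h2 : rootFunctional M j (z - (x • single i 1 + y • single j 1)) = 0 := by
    simp only [map_sub, map_add, map_smul, rootFunctional_single_self, rootFunctional_single,
      smul_eq_mul, M.symmetric j i]
    change q - (x * -c + y * 2) = 0
    rw [hx, hy]
    field_simp
    ring
  have hfix : ∀ n : ℕ, ((geomReflection M i * geomReflection M j) ^ n)
      (z - (x • single i 1 + y • single j 1)) = z - (x • single i 1 + y • single j 1) := by
    intro n
    induction n with
    | zero => rfl
    | succ n ih =>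
      rw [pow_succ, Module.End.mul_apply, Module.End.mul_apply, geomReflection_apply j, h2,
        zero_smul, sub_zero, geomReflection_apply i, h1, zero_smul, sub_zero, ih]
  have hz : z = (z - (x • single i 1 + y • single j 1)) + (x • single i 1 + y • single j 1) := by
    abel
  rw [Module.End.one_apply, hz, map_add, map_add, map_smul, map_smul, hi, hj, hT, hfix]

theorem isLiftable_geomReflection : M.IsLiftable (geomReflection M) := by
  intro i j
  by_cases hij : i = j
  · subst hij
    rw [M.diagonal, pow_one, geomReflection_mul_self]
  · exact geomReflection_mul_pow_eq_one hij

variable (cs : CoxeterSystem M W)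

/-- The geometric representation of a Coxeter group. -/
noncomputable def geomRep : W →* Module.End ℝ (B →₀ ℝ) :=
  cs.lift ⟨geomReflection M, isLiftable_geomReflection⟩

theorem geomRep_simple (i : B) : cs.geomRep (cs.simple i) = geomReflection M i :=
  cs.lift_apply_simple isLiftable_geomReflection i

theorem geomRep_ne_zero (w : W) {v : B →₀ ℝ} (hv : v ≠ 0) : cs.geomRep w v ≠ 0 := by
  intro h
  apply hv
  have : cs.geomRep w⁻¹ (cs.geomRep w v) = v := by
    rw [← Module.End.mul_apply, ← map_mul, inv_mul_cancel, map_one, Module.End.one_apply]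
  rw [← this, h, map_zero]

/-- The sequence `sin (n φ) / sin φ` for `c = 2 cos φ`, by its recursion. -/
def sinSeq (c : ℝ) : ℕ → ℝ
  | 0 => 0
  | 1 => 1
  | n + 2 => c * sinSeq c (n + 1) - sinSeq c n

theorem sinSeq_mul_sin (φ : ℝ) (n : ℕ) :
    sinSeq (2 * Real.cos φ) n * Real.sin φ = Real.sin (n * φ) := by
  induction n using Nat.twoStepInduction with
  | zero => simp [sinSeq]
  | one => simp [sinSeq]
  | more n h1 h2 =>
    have e1 : ((n + 2 : ℕ) : ℝ) * φ = ((n + 1 : ℕ) : ℝ) * φ + φ := by push_cast; ring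
    have e2 : (n : ℝ) * φ = ((n + 1 : ℕ) : ℝ) * φ - φ := by push_cast; ring
    rw [sinSeq, sub_mul, h1, mul_assoc, h2, e1, e2, Real.sin_sub, Real.sin_add]
    ring

/-- The case `m(i, j) = ∞`, encoded by `M i j = 0`: the angle is `0` and `c = 2`. -/
theorem sinSeq_two (n : ℕ) : sinSeq 2 n = n := by
  induction n using Nat.twoStepInduction with
  | zero => simp [sinSeq]
  | one => simp [sinSeq]
  | more n h1 h2 =>
    rw [sinSeq, h1, h2]
    push_cast
    ring

theorem sinSeq_nonneg {m n : ℕ} (hm : m ≠ 1) (hn : m = 0 ∨ n ≤ m) :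
    0 ≤ sinSeq (2 * Real.cos (Real.pi / m)) n := by
  rcases Nat.eq_zero_or_pos m with rfl | hpos
  · simp [sinSeq_two]
  · have hn : n ≤ m := by omega
    have hs := sin_pi_div_pos (m := m) (by omega)
    refine nonneg_of_mul_nonneg_left ?_ hs
    rw [sinSeq_mul_sin]
    have hm' : (0 : ℝ) < m := by exact_mod_cast hpos
    have hn' : (n : ℝ) ≤ m := by exact_mod_cast hn
    have := Real.pi_pos
    apply Real.sin_nonneg_of_nonneg_of_le_pi
    · positivity
    · rw [mul_div_assoc', div_le_iff₀ hm']
      nlinarith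

/-- Each new letter changes one coordinate only, by the recursion of `sinSeq`; the parity of `k`
decides which one. -/
theorem geomRep_alternatingWord (i j : B) (k : ℕ) :
    cs.geomRep (cs.wordProd (alternatingWord i j k)) (single i 1) =
      sinSeq (2 * Real.cos (Real.pi / M i j)) (if Even k then k + 1 else k) • single i 1 +
        sinSeq (2 * Real.cos (Real.pi / M i j)) (if Even k then k else k + 1) • single j 1 := by
  induction k with
  | zero => simp [alternatingWord, sinSeq]
  | succ k ih =>
    rw [alternatingWord_succ', wordProd_cons, map_mul, Module.End.mul_apply, ih, geomRep_simple]
    by_cases hk : Even k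
    · simp only [hk, if_true, geomReflection_right, Nat.even_add_one, not_true, if_false]
      rfl
    · simp only [hk, if_false, geomReflection_left, Nat.even_add_one, not_false_eq_true, if_true]
      rfl

/-! ### Dihedral factorizations and positivity -/

/-- Strip the descents `j`, `i`, `j`, ... from the right. After each step the letter just removed is
no longer a descent, so the roles of `i` and `j` swap in the induction. -/
theorem exists_alternatingWord_factorization {i j : B} {w : W} (hi : ¬ cs.IsRightDescent w i) :
    ∃ (y : W) (k : ℕ), w = y * cs.wordProd (alternatingWord i j k) ∧
      cs.length w = cs.length y + k ∧ ¬ cs.IsRightDescent y i ∧ ¬ cs.IsRightDescent y j := by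
  induction hn : cs.length w using Nat.strong_induction_on generalizing w i j with
  | _ n ih =>
    by_cases hj : cs.IsRightDescent w j
    · have hlt : cs.length (w * cs.simple j) < n := hn ▸ hj
      obtain ⟨y, k, h1, h2, h3, h4⟩ := ih _ hlt (i := j) (j := i) (w := w * cs.simple j)
        (cs.isRightDescent_iff_not_isRightDescent_mul.1 hj) rfl
      refine ⟨y, k + 1, ?_, ?_, h4, h3⟩
      · rw [alternatingWord_succ, wordProd_concat, ← mul_assoc, ← h1,
          simple_mul_simple_cancel_right]
      · rw [isRightDescent_iff] at hj
        omega
    · exact ⟨w, 0, by simp [alternatingWord], by omega, hi, hj⟩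

theorem le_of_length_eq_add {i j : B} {y : W} {k : ℕ}
    (h : cs.length (y * cs.wordProd (alternatingWord i j k)) = cs.length y + k) :
    M i j = 0 ∨ k ≤ M i j := by
  by_contra! hcon
  have h1 := cs.not_isReduced_alternatingWord i j hcon.1 hcon.2
  have h2 := cs.length_wordProd_le (alternatingWord i j k)
  have h3 := cs.length_mul_le y (cs.wordProd (alternatingWord i j k))
  rw [IsReduced] at h1
  rw [length_alternatingWord] at h1 h2
  omega

theorem geomRep_alternatingWord_nonneg {i j : B} (hij : i ≠ j) {y : W} {k : ℕ}
    (hk : M i j = 0 ∨ k + 1 ≤ M i j) (hi : 0 ≤ cs.geomRep y (single i 1))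
    (hj : 0 ≤ cs.geomRep y (single j 1)) :
    0 ≤ cs.geomRep (y * cs.wordProd (alternatingWord i j k)) (single i 1) := by
  rw [map_mul, Module.End.mul_apply, geomRep_alternatingWord, map_add, map_smul, map_smul]
  have hm := M.off_diagonal i j hij
  refine add_nonneg (smul_nonneg (sinSeq_nonneg hm ?_) hi) (smul_nonneg (sinSeq_nonneg hm ?_) hj)
  · split_ifs <;> omega
  · split_ifs <;> omega

/-- Factor `w` as a shorter `y` without descents `i`, `j`, times an alternating word. That word
sends the simple root of `i` to a nonnegative combination of the roots of `i` and `j`, and `y` keeps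
both nonnegative by induction. -/
theorem geomRep_single_nonneg {w : W} {i : B} (hi : ¬ cs.IsRightDescent w i) :
    0 ≤ cs.geomRep w (single i 1) := by
  induction hn : cs.length w using Nat.strong_induction_on generalizing w i with
  | _ n ih =>
    by_cases hw : w = 1
    · subst hw
      simp
    obtain ⟨j, hj⟩ := cs.exists_rightDescent_of_ne_one hw
    have hij : i ≠ j := by
      rintro rfl
      exact hi hj
    obtain ⟨y, k, h1, h2, h3, h4⟩ := cs.exists_alternatingWord_factorization (j := j) hi
    have hk : k ≠ 0 := by
      rintro rfl
      simp only [alternatingWord, wordProd_nil, mul_one] at h1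
      exact h4 (h1 ▸ hj)
    have hlt : cs.length y < n := by omega
    rw [h1]
    refine cs.geomRep_alternatingWord_nonneg hij ?_ (ih _ hlt h3 rfl) (ih _ hlt h4 rfl)
    -- The alternating word can be prolonged by `i` with length still adding up, so `k + 1` is at
    -- most `M j i` when that is finite.
    rw [M.symmetric i j]
    refine cs.le_of_length_eq_add (y := y) ?_
    rw [alternatingWord_succ, wordProd_concat, ← mul_assoc, ← h1]
    rw [not_isRightDescent_iff] at hi
    omega

/-- If `i` were a descent, positivity for `w * s i` would make the image of the simple root
nonpositive as well, hence zero, but `w` acts invertibly. -/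
theorem not_isRightDescent_of_nonneg {w : W} {i : B} (h : 0 ≤ cs.geomRep w (single i 1)) :
    ¬ cs.IsRightDescent w i := by
  intro hd
  have h1 := cs.geomRep_single_nonneg (cs.isRightDescent_iff_not_isRightDescent_mul.1 hd)
  rw [map_mul, Module.End.mul_apply, geomRep_simple, geomReflection_apply,
    rootFunctional_single_self] at h1
  have h2 : single i (1 : ℝ) - (2 : ℝ) • single i (1 : ℝ) = -single i (1 : ℝ) := by module
  rw [h2, map_neg] at h1
  exact cs.geomRep_ne_zero w (by simp) (le_antisymm (neg_nonneg.1 h1) h)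

/-- If `y` is minimal in its coset of the dihedral subgroup of `i, j`, then multiplying it on the
right by an alternating word of length at most `m(i, j)` adds the lengths. -/
theorem length_mul_alternatingWord {i j : B} (hij : i ≠ j) {y : W}
    (hi : ¬ cs.IsRightDescent y i) (hj : ¬ cs.IsRightDescent y j) {k : ℕ}
    (hk : M i j = 0 ∨ k ≤ M i j) :
    cs.length (y * cs.wordProd (alternatingWord i j k)) = cs.length y + k := by
  induction k generalizing i j with
  | zero => simp [alternatingWord]
  | succ k ih =>
    rw [M.symmetric i j] at hk
    have h := ih hij.symm hj hi (by omega)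
    -- Positivity of the image of the root of `j` shows that appending `j` increases the length.
    have h2 := cs.not_isRightDescent_of_nonneg (cs.geomRep_alternatingWord_nonneg hij.symm hk
      (cs.geomRep_single_nonneg hj) (cs.geomRep_single_nonneg hi))
    rw [not_isRightDescent_iff] at h2
    rw [alternatingWord_succ, wordProd_concat, ← mul_assoc, h2, h, add_assoc]

/-- Otherwise alternating words in `i` and `j` would give elements of unbounded length. -/
theorem coxeterMatrix_ne_zero [Finite W] (cs : CoxeterSystem M W) (i j : B) : M i j ≠ 0 := by
  intro h
  have hij : i ≠ j := by
    rintro rfl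
    simp at h
  obtain ⟨w, hw⟩ := Finite.exists_max cs.length
  have h1 := cs.length_mul_alternatingWord hij (cs.not_isRightDescent_one i)
    (cs.not_isRightDescent_one j) (k := cs.length w + 1) (Or.inl h)
  have h2 := hw (1 * cs.wordProd (alternatingWord i j (cs.length w + 1)))
  rw [length_one] at h1
  omega

theorem simple_injective (cs : CoxeterSystem M W) : Function.Injective cs.simple := by
  intro i j h
  by_contra hij
  have hM := M.off_diagonal i j hij
  have h1 := cs.length_mul_alternatingWord hij (cs.not_isRightDescent_one i)
    (cs.not_isRightDescent_one j) (k := 2) (by omega)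
  simp [alternatingWord, wordProd_cons, h] at h1

theorem finite_index [Finite W] (cs : CoxeterSystem M W) : Finite B :=
  Finite.of_injective _ cs.simple_injective

theorem exists_mul_braidWord_of_isRightDescent {i j : B} (hij : i ≠ j) {u : W}
    (hi : cs.IsRightDescent u i) (hj : cs.IsRightDescent u j) :
    ∃ y : W, u = y * cs.wordProd (braidWord M j i) ∧ cs.length u = cs.length y + M j i := by
  obtain ⟨y, k, h1, h2, h3, h4⟩ := cs.exists_alternatingWord_factorization (j := j)
    (cs.isRightDescent_iff_not_isRightDescent_mul.1 hi)
  have hu : u = y * cs.wordProd (alternatingWord j i (k + 1)) := by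
    rw [alternatingWord_succ, wordProd_concat, ← mul_assoc, ← h1, simple_mul_simple_cancel_right]
  have hl : cs.length u = cs.length y + (k + 1) := by
    rw [isRightDescent_iff] at hi
    omega
  have hle : M j i = 0 ∨ k + 1 ≤ M j i := cs.le_of_length_eq_add (y := y) (by rw [← hu, hl])
  -- If the alternating word were shorter than `M j i`, appending `j` would still increase the
  -- length, against the descent `j`.
  have hk : M j i = k + 1 := by
    by_contra hne
    have := cs.length_mul_alternatingWord hij h3 h4 (k := k + 2) (by rw [M.symmetric i j]; omega)
    rw [alternatingWord_succ, wordProd_concat, ← mul_assoc, ← hu] at this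
    rw [isRightDescent_iff] at hj
    omega
  exact ⟨y, by rw [braidWord, hk, ← hu], by rw [hl, hk]⟩

end CoxeterSystem

/-- A terminating, locally confluent ascending relation has greatest elements: let `E` be a set on
which the rank is bounded, such that below any pair `x ≤ y` in `E` there is a step from `x` towards
`y`, and any two steps from `x` inside `E` have a common upper bound in `E`. Then the elements of
`E` above any `x ∈ E` have a greatest element. -/
theorem exists_greatest_of_locally_confluent {X : Type*} {r step : X → X → Prop}
    (hrefl : ∀ x, r x x) (htrans : ∀ x y z, r x y → r y z → r x z)
    {E : Set X} (rk : X → ℕ) (N : ℕ) (hN : ∀ x ∈ E, rk x ≤ N)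
    (hrk : ∀ x y, step x y → rk x < rk y)
    (hr : ∀ x y, step x y → r x y)
    (hex : ∀ x ∈ E, ∀ y ∈ E, r x y → x = y ∨ ∃ z ∈ E, step x z ∧ r z y)
    (hconf : ∀ x ∈ E, ∀ y ∈ E, ∀ z ∈ E, step x y → step x z → ∃ u ∈ E, r y u ∧ r z u)
    {x : X} (hx : x ∈ E) : ∃ g ∈ E, r x g ∧ ∀ y ∈ E, r x y → r y g := by
  induction hn : N - rk x using Nat.strong_induction_on generalizing x with
  | _ n ih =>
    have ih' : ∀ a ∈ E, step x a → ∃ g ∈ E, r a g ∧ ∀ y ∈ E, r a y → r y g := by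
      intro a ha hxa
      refine ih (N - rk a) ?_ ha rfl
      have h1 := hrk x a hxa
      have h2 := hN a ha
      omega
    by_cases h : ∃ a ∈ E, step x a
    · obtain ⟨a, ha, hxa⟩ := h
      obtain ⟨g, hg, hag, hmax⟩ := ih' a ha hxa
      refine ⟨g, hg, htrans _ _ _ (hr _ _ hxa) hag, fun y hy hxy => ?_⟩
      rcases hex x hx y hy hxy with rfl | ⟨b, hb, hxb, hby⟩
      · exact htrans _ _ _ (hr _ _ hxa) hag
      · obtain ⟨u, hu, hau, hbu⟩ := hconf x hx a ha b hb hxa hxb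
        obtain ⟨g', hg', hbg', hmax'⟩ := ih' b hb hxb
        -- Newman's argument: `y` is below `g'`, the greatest element above `b`; and `a` is below
        -- `u`, which is below `g'`, so `g'` is below `g`.
        exact htrans _ _ _ (hmax' y hy hby) (hmax g' hg'
          (htrans _ _ _ hau (hmax' u hu hbu)))
    · refine ⟨x, hx, hrefl x, fun y hy hxy => ?_⟩
      rcases hex x hx y hy hxy with rfl | ⟨b, hb, hxb, -⟩
      · exact hrefl _
      · exact absurd ⟨b, hb, hxb⟩ h

namespace CoxeterSystem

variable {B W : Type*} [Group W] {M : CoxeterMatrix B}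

/-! ### Braid pairs -/

/-- `i :: p` and `j :: q` are the two sides of the braid relation of `i` and `j`. -/
def IsBraidPair (M : CoxeterMatrix B) (i j : B) (p q : List B) : Prop :=
  (i :: p = braidWord M i j ∧ j :: q = braidWord M j i) ∨
    (i :: p = braidWord M j i ∧ j :: q = braidWord M i j)

theorem IsBraidPair.symm {i j : B} {p q : List B} (h : IsBraidPair M i j p q) :
    IsBraidPair M j i q p := by
  rcases h with ⟨h1, h2⟩ | ⟨h1, h2⟩
  · exact Or.inl ⟨h2, h1⟩
  · exact Or.inr ⟨h2, h1⟩

/-- The last letter of `braidWord M i j` is `j`, but its first letter depends on the parity of `M i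
j`; this is why a braid pair is a disjunction. -/
theorem exists_isBraidPair {i j : B} (hM : M i j ≠ 0) : ∃ p q, IsBraidPair M i j p q := by
  obtain ⟨m, hm⟩ := Nat.exists_eq_succ_of_ne_zero hM
  have hm' : M j i = m + 1 := by rw [M.symmetric j i, hm]
  by_cases h : Even m
  · refine ⟨alternatingWord j i m, alternatingWord i j m, Or.inr ⟨?_, ?_⟩⟩
    · rw [braidWord, hm', alternatingWord_succ', if_pos h]
    · rw [braidWord, hm, Nat.succ_eq_add_one, alternatingWord_succ', if_pos h]
  · refine ⟨alternatingWord i j m, alternatingWord j i m, Or.inl ⟨?_, ?_⟩⟩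
    · rw [braidWord, hm, Nat.succ_eq_add_one, alternatingWord_succ', if_neg h]
    · rw [braidWord, hm', alternatingWord_succ', if_neg h]

variable (cs : CoxeterSystem M W)

theorem IsBraidPair.wordProd_eq {i j : B} {p q : List B} (h : IsBraidPair M i j p q) :
    cs.wordProd (i :: p) = cs.wordProd (j :: q) := by
  rcases h with ⟨h1, h2⟩ | ⟨h1, h2⟩
  · rw [h1, h2, wordProd_braidWord_eq]
  · rw [h1, h2, wordProd_braidWord_eq]

theorem IsBraidPair.wordProd_eq_braidWord {i j : B} {p q : List B} (h : IsBraidPair M i j p q) :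
    cs.wordProd (i :: p) = cs.wordProd (braidWord M i j) := by
  rcases h with ⟨h1, -⟩ | ⟨h1, -⟩
  · rw [h1]
  · rw [h1, wordProd_braidWord_eq]

theorem wordProd_braidWord_inv (i j : B) :
    (cs.wordProd (braidWord M i j))⁻¹ = cs.wordProd (braidWord M i j) := by
  rw [← wordProd_reverse, braidWord, Artin.reverse_alternatingWord]
  split_ifs
  · have h := cs.wordProd_braidWord_eq j i
    rwa [braidWord, M.symmetric j i] at h
  · rfl

/-! ### Length-additive products -/

/-- The product `x * y` is length-additive. -/
def Additive (x y : W) : Prop := cs.length (x * y) = cs.length x + cs.length y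

variable {cs}

/-- Both bracketings of a triple product are additive exactly when the three lengths add up, by
subadditivity; the next lemmas move between them. -/
theorem Additive.left_of_mul {x y z : W} (h : cs.Additive x (y * z)) (h' : cs.Additive y z) :
    cs.Additive x y := by
  rw [Additive] at *
  have h1 := cs.length_mul_le (x * y) z
  have h2 := cs.length_mul_le x y
  rw [mul_assoc] at h1
  omega

theorem Additive.mul_left {x y z : W} (h : cs.Additive x (y * z)) (h' : cs.Additive y z) :
    cs.Additive (x * y) z := by
  have h3 := h.left_of_mul h'
  rw [Additive] at *
  rw [mul_assoc]
  omega

theorem Additive.right_of_mul {x y z : W} (h : cs.Additive (x * y) z) (h' : cs.Additive x y) :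
    cs.Additive y z := by
  rw [Additive] at *
  have h1 := cs.length_mul_le x (y * z)
  have h2 := cs.length_mul_le y z
  rw [← mul_assoc] at h1
  omega

theorem Additive.mul_right {x y z : W} (h : cs.Additive (x * y) z) (h' : cs.Additive x y) :
    cs.Additive x (y * z) := by
  have h3 := h.right_of_mul h'
  rw [Additive] at *
  rw [← mul_assoc]
  omega

variable (cs)

theorem additive_one_left (x : W) : cs.Additive 1 x := by simp [Additive]

theorem additive_one_right (x : W) : cs.Additive x 1 := by simp [Additive]

theorem additive_simple_right_iff {y : W} {i : B} :
    cs.Additive y (cs.simple i) ↔ ¬ cs.IsRightDescent y i := by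
  rw [Additive, length_simple, not_isRightDescent_iff]

theorem additive_simple_left_iff {y : W} {i : B} :
    cs.Additive (cs.simple i) y ↔ ¬ cs.IsLeftDescent y i := by
  rw [Additive, length_simple, not_isLeftDescent_iff, add_comm]

theorem additive_simple_simple_mul_iff {y : W} {i : B} :
    cs.Additive (cs.simple i) (cs.simple i * y) ↔ cs.IsLeftDescent y i := by
  rw [additive_simple_left_iff, ← isLeftDescent_iff_not_isLeftDescent_mul]

theorem IsReduced.additive {ω ω' : List B} (h : cs.IsReduced (ω ++ ω')) :
    cs.IsReduced ω ∧ cs.IsReduced ω' ∧ cs.Additive (cs.wordProd ω) (cs.wordProd ω') := by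
  have h1 : cs.IsReduced ω := by simpa using h.take ω.length
  have h2 : cs.IsReduced ω' := by simpa using h.drop ω.length
  refine ⟨h1, h2, ?_⟩
  rw [Additive, ← wordProd_append, h, h1, h2, List.length_append]

theorem IsReduced.append {ω ω' : List B} (h : cs.IsReduced ω) (h' : cs.IsReduced ω')
    (h'' : cs.Additive (cs.wordProd ω) (cs.wordProd ω')) : cs.IsReduced (ω ++ ω') := by
  rw [IsReduced, wordProd_append, h'', h, h', List.length_append]

theorem isReduced_singleton (i : B) : cs.IsReduced [i] := by
  rw [IsReduced, wordProd_singleton, length_simple, List.length_singleton]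

theorem IsReduced.of_cons {i : B} {ω : List B} (h : cs.IsReduced (i :: ω)) :
    cs.IsReduced ω ∧ cs.Additive (cs.simple i) (cs.wordProd ω) := by
  have := IsReduced.additive cs (ω := [i]) (ω' := ω) h
  rw [wordProd_singleton] at this
  exact this.2

theorem isReduced_braidWord {i j : B} (hij : i ≠ j) : cs.IsReduced (braidWord M i j) := by
  have := cs.length_mul_alternatingWord hij (cs.not_isRightDescent_one i)
    (cs.not_isRightDescent_one j) (k := M i j) (by omega)
  rw [one_mul, length_one, zero_add] at this
  rw [IsReduced, this, length_alternatingWord]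

theorem IsBraidPair.isReduced {i j : B} (hij : i ≠ j) {p q : List B}
    (h : IsBraidPair M i j p q) : cs.IsReduced (i :: p) := by
  rcases h with ⟨h1, -⟩ | ⟨h1, -⟩
  · rw [h1]
    exact cs.isReduced_braidWord hij
  · rw [h1]
    exact cs.isReduced_braidWord hij.symm

theorem IsBraidPair.additive {i j : B} (hij : i ≠ j) {p q : List B} (h : IsBraidPair M i j p q)
    {y : W} (hi : cs.Additive y (cs.simple i)) (hj : cs.Additive y (cs.simple j)) :
    cs.Additive y (cs.wordProd (i :: p)) := by
  rw [additive_simple_right_iff] at hi hj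
  rw [h.wordProd_eq_braidWord, Additive, cs.isReduced_braidWord hij, length_alternatingWord]
  exact cs.length_mul_alternatingWord hij hi hj (by omega)

/-- The inverse of `exists_mul_braidWord_of_isRightDescent`: the longest element of a dihedral
subgroup is an involution. -/
theorem IsBraidPair.exists_of_isLeftDescent {i j : B} (hij : i ≠ j) {p q : List B}
    (h : IsBraidPair M i j p q) {u : W} (hi : cs.IsLeftDescent u i) (hj : cs.IsLeftDescent u j) :
    ∃ v : W, u = cs.wordProd (i :: p) * v ∧ cs.Additive (cs.wordProd (i :: p)) v := by
  rw [← isRightDescent_inv_iff] at hi hj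
  obtain ⟨y, h1, h2⟩ := cs.exists_mul_braidWord_of_isRightDescent hij.symm hj hi
  have hu : u = cs.wordProd (braidWord M i j) * y⁻¹ := by
    rw [← wordProd_braidWord_inv, ← mul_inv_rev, ← h1, inv_inv]
  rw [h.wordProd_eq_braidWord]
  refine ⟨y⁻¹, hu, ?_⟩
  rw [Additive, ← hu, cs.isReduced_braidWord hij, length_alternatingWord, length_inv,
    ← length_inv, h2, add_comm]

end CoxeterSystem

namespace Artin

open CoxeterSystem

variable {B W : Type*} [Group W]

/-! ### The abstract Artin monoid -/

/-- The braid relations on the free monoid. -/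
def braidRel (M : CoxeterMatrix B) (x y : FreeMonoid B) : Prop :=
  ∃ i j, x = FreeMonoid.ofList (braidWord M i j) ∧ y = FreeMonoid.ofList (braidWord M j i)

/-- The monoid presented by the braid relations. -/
abbrev BraidMonoid (M : CoxeterMatrix B) : Type _ := PresentedMonoid (braidRel M)

/-- The element of the presented monoid represented by a word. -/
def braidMk (M : CoxeterMatrix B) (ω : List B) : BraidMonoid M :=
  PresentedMonoid.mk (braidRel M) (FreeMonoid.ofList ω)

variable {M : CoxeterMatrix B}

theorem braidMk_nil : braidMk M [] = 1 := rfl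

theorem braidMk_append (ω ω' : List B) : braidMk M (ω ++ ω') = braidMk M ω * braidMk M ω' := rfl

theorem braidMk_cons (i : B) (ω : List B) : braidMk M (i :: ω) = braidMk M [i] * braidMk M ω := rfl

theorem braidMk_surjective : Function.Surjective (braidMk M) := by
  intro b
  obtain ⟨x, rfl⟩ := PresentedMonoid.surjective_mk b
  exact ⟨x.toList, rfl⟩

theorem braidMk_braidWord (i j : B) : braidMk M (braidWord M i j) = braidMk M (braidWord M j i) :=
  PresentedMonoid.mk_eq_mk_of_rel ⟨i, j, rfl, rfl⟩

theorem braidMk_eq_of_isBraidPair {i j : B} {p q : List B} (h : IsBraidPair M i j p q) :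
    braidMk M (i :: p) = braidMk M (j :: q) := by
  rcases h with ⟨h1, h2⟩ | ⟨h1, h2⟩
  · rw [h1, h2, braidMk_braidWord]
  · rw [h1, h2, braidMk_braidWord]

/-! ### Matsumoto's theorem and the lift of the Coxeter group. -/

variable (cs : CoxeterSystem M W) [Finite W]

/-- Matsumoto's theorem: two reduced words of the same element are related by braid relations. -/
theorem braidMk_eq_of_isReduced {ω ω' : List B} (h : cs.IsReduced ω) (h' : cs.IsReduced ω')
    (heq : cs.wordProd ω = cs.wordProd ω') : braidMk M ω = braidMk M ω' := by
  induction hn : ω.length using Nat.strong_induction_on generalizing ω ω' with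
  | _ n ih =>
    have hlen : ω'.length = ω.length := by rw [← h, ← h', heq]
    match ω, ω', hlen with
    | [], [], _ => rfl
    | i :: ω, j :: ω', hlen =>
      obtain ⟨h1, h2⟩ := h.of_cons
      obtain ⟨h1', h2'⟩ := h'.of_cons
      simp only [List.length_cons] at hn hlen
      by_cases hij : i = j
      · subst hij
        rw [wordProd_cons, wordProd_cons] at heq
        rw [braidMk_cons i ω, braidMk_cons i ω', ih ω.length (by omega) h1 h1' (mul_left_cancel heq) rfl]
      · obtain ⟨p, q, hpq⟩ := exists_isBraidPair (cs.coxeterMatrix_ne_zero i j)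
        have hdi : cs.IsLeftDescent (cs.wordProd (i :: ω)) i := by
          rw [← additive_simple_simple_mul_iff, wordProd_cons, simple_mul_simple_cancel_left]
          exact h2
        have hdj : cs.IsLeftDescent (cs.wordProd (i :: ω)) j := by
          rw [heq, ← additive_simple_simple_mul_iff, wordProd_cons, simple_mul_simple_cancel_left]
          exact h2'
        -- Both words are compared with reduced words that begin with the two sides of the braid
        -- relation and share the ending `τ`; the induction applies after the first letter.
        obtain ⟨v, hv, hav⟩ := hpq.exists_of_isLeftDescent cs hij hdi hdj
        obtain ⟨τ, hτ, rfl⟩ := cs.exists_isReduced v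
        have hri := (hpq.isReduced cs hij).append cs hτ hav
        rw [hpq.wordProd_eq] at hav
        have hrj := (hpq.symm.isReduced cs (Ne.symm hij)).append cs hτ hav
        rw [List.cons_append] at hri hrj
        have e1 : cs.wordProd ω = cs.wordProd (p ++ τ) := by
          rw [wordProd_cons, wordProd_cons, mul_assoc, ← wordProd_append] at hv
          exact mul_left_cancel hv
        have e2 : cs.wordProd ω' = cs.wordProd (q ++ τ) := by
          rw [heq, hpq.wordProd_eq, wordProd_cons, wordProd_cons, mul_assoc,
            ← wordProd_append] at hv
          exact mul_left_cancel hv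
        rw [braidMk_cons i ω, braidMk_cons j ω', ih ω.length (by omega) h1 hri.of_cons.1 e1 rfl,
          ih ω'.length (by omega) h1' hrj.of_cons.1 e2 rfl, ← braidMk_cons, ← braidMk_cons,
          ← List.cons_append, ← List.cons_append, braidMk_append, braidMk_append,
          braidMk_eq_of_isBraidPair hpq]

/-- The lift of an element of the Coxeter group to the presented monoid, by a reduced word. -/
noncomputable def braidLift (w : W) : BraidMonoid M := braidMk M (cs.exists_isReduced w).choose

theorem braidLift_wordProd {ω : List B} (h : cs.IsReduced ω) :
    braidLift cs (cs.wordProd ω) = braidMk M ω :=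
  have hs := (cs.exists_isReduced (cs.wordProd ω)).choose_spec
  braidMk_eq_of_isReduced cs hs.1 h hs.2.symm

theorem braidLift_one : braidLift cs 1 = 1 := by
  rw [← braidMk_nil, ← braidLift_wordProd cs (ω := []) (by simp [CoxeterSystem.IsReduced]), wordProd_nil]

theorem braidLift_simple (i : B) : braidLift cs (cs.simple i) = braidMk M [i] := by
  rw [← braidLift_wordProd cs (cs.isReduced_singleton i), wordProd_singleton]

theorem braidLift_mul {x y : W} (h : cs.Additive x y) :
    braidLift cs (x * y) = braidLift cs x * braidLift cs y := by
  obtain ⟨ω, hω, rfl⟩ := cs.exists_isReduced x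
  obtain ⟨ω', hω', rfl⟩ := cs.exists_isReduced y
  rw [← wordProd_append, braidLift_wordProd cs (hω.append cs hω' h), braidLift_wordProd cs hω,
    braidLift_wordProd cs hω', braidMk_append]

end Artin

namespace CoxeterSystem

variable {B W : Type*} [Group W] {M : CoxeterMatrix B} (cs : CoxeterSystem M W)

/-! ### The weak order of the Coxeter group -/

/-- The right weak order on the Coxeter group. -/
def WeakLE (v w : W) : Prop := ∃ a, v * a = w ∧ cs.Additive v a

variable {cs}

theorem WeakLE.refl (v : W) : cs.WeakLE v v := ⟨1, mul_one v, cs.additive_one_right v⟩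

theorem WeakLE.trans {u v w : W} (h : cs.WeakLE u v) (h' : cs.WeakLE v w) : cs.WeakLE u w := by
  obtain ⟨a, rfl, ha⟩ := h
  obtain ⟨b, rfl, hb⟩ := h'
  exact ⟨a * b, (mul_assoc _ _ _).symm, hb.mul_right ha⟩

theorem WeakLE.length_le {v w : W} (h : cs.WeakLE v w) : cs.length v ≤ cs.length w := by
  obtain ⟨a, rfl, ha⟩ := h
  rw [ha]
  omega

theorem WeakLE.eq_of_length_le {v w : W} (h : cs.WeakLE v w) (h' : cs.length w ≤ cs.length v) :
    v = w := by
  obtain ⟨a, rfl, ha⟩ := h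
  have : a = 1 := by
    rw [← cs.length_eq_zero_iff]
    rw [ha] at h'
    omega
  rw [this, mul_one]

theorem WeakLE.additive_of_le {x v w : W} (h : cs.WeakLE v w) (h' : cs.Additive x w) :
    cs.Additive x v := by
  obtain ⟨a, rfl, ha⟩ := h
  exact h'.left_of_mul ha

theorem WeakLE.eq_or_exists_step {v w : W} (h : cs.WeakLE v w) :
    v = w ∨ ∃ z, (∃ i, z = v * cs.simple i ∧ cs.Additive v (cs.simple i)) ∧ cs.WeakLE z w := by
  obtain ⟨a, rfl, ha⟩ := h
  by_cases h1 : a = 1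
  · exact Or.inl (by rw [h1, mul_one])
  · obtain ⟨i, hi⟩ := cs.exists_leftDescent_of_ne_one h1
    rw [← additive_simple_simple_mul_iff] at hi
    rw [← cs.simple_mul_simple_cancel_left (w := a) i] at ha
    exact Or.inr ⟨v * cs.simple i, ⟨i, rfl, ha.left_of_mul hi⟩, cs.simple i * a,
      by rw [mul_assoc, simple_mul_simple_cancel_left], ha.mul_left hi⟩

variable (cs)

/-- If `v * s i` and `v * s j` are both covers of `v` below `w`, then so is `v` times the longest
element of the dihedral subgroup of `i` and `j`. -/
theorem weakLE_mul_braidWord {i j : B} (hij : i ≠ j) {p q : List B}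
    (hpq : IsBraidPair M i j p q) {v w : W} (hi : cs.Additive v (cs.simple i))
    (hj : cs.Additive v (cs.simple j)) (hiw : cs.WeakLE (v * cs.simple i) w)
    (hjw : cs.WeakLE (v * cs.simple j) w) : cs.WeakLE (v * cs.wordProd (i :: p)) w := by
  obtain ⟨a, rfl, ha⟩ := hiw
  obtain ⟨b, hb, hb'⟩ := hjw
  have hab : cs.simple i * a = cs.simple j * b := by
    rw [mul_assoc, mul_assoc] at hb
    exact (mul_left_cancel hb).symm
  have hdi : cs.IsLeftDescent (cs.simple i * a) i := by
    rw [← additive_simple_simple_mul_iff, simple_mul_simple_cancel_left]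
    exact ha.right_of_mul hi
  have hdj : cs.IsLeftDescent (cs.simple i * a) j := by
    rw [hab, ← additive_simple_simple_mul_iff, simple_mul_simple_cancel_left]
    exact hb'.right_of_mul hj
  obtain ⟨c, hc, hac⟩ := hpq.exists_of_isLeftDescent cs hij hdi hdj
  have hva := ha.mul_right hi
  rw [hc] at hva
  exact ⟨c, by rw [mul_assoc v, ← hc, mul_assoc], hva.mul_left hac⟩

theorem weakLE_braidWord {i j : B} (hij : i ≠ j) {p q : List B}
    (hpq : IsBraidPair M i j p q) {v : W} (hi : cs.Additive v (cs.simple i))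
    (hj : cs.Additive v (cs.simple j)) :
    cs.WeakLE (v * cs.simple i) (v * cs.wordProd (i :: p)) ∧
      cs.WeakLE (v * cs.simple j) (v * cs.wordProd (i :: p)) := by
  have h1 := hpq.additive cs hij hi hj
  have h2 := h1
  rw [hpq.wordProd_eq] at h2
  have h3 := (hpq.isReduced cs hij).of_cons.2
  have h4 := (hpq.symm.isReduced cs hij.symm).of_cons.2
  rw [wordProd_cons] at h1 h2
  refine ⟨⟨cs.wordProd p, by rw [wordProd_cons, mul_assoc], h1.mul_left h3⟩, ?_⟩
  rw [hpq.wordProd_eq]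
  exact ⟨cs.wordProd q, by rw [wordProd_cons, mul_assoc], h2.mul_left h4⟩

variable [Finite W]

/-- Local confluence: if `v * s i` and `v * s j` satisfy both conditions, so does `v` times the
dihedral longest element. Additivity survives because neither `i` nor `j` is a right descent of `x *
v`. -/
theorem exists_greatest_weakLE_additive (x w : W) :
    ∃ g, (cs.WeakLE g w ∧ cs.Additive x g) ∧
      ∀ v, cs.WeakLE v w → cs.Additive x v → cs.WeakLE v g := by
  have h1 : ∀ v, cs.WeakLE 1 v := fun v => ⟨v, one_mul v, cs.additive_one_left v⟩
  obtain ⟨g, hg, -, hmax⟩ := exists_greatest_of_locally_confluent (r := cs.WeakLE)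
    (step := fun v v' => ∃ i, v' = v * cs.simple i ∧ cs.Additive v (cs.simple i))
    WeakLE.refl (fun _ _ _ => WeakLE.trans) (E := {v | cs.WeakLE v w ∧ cs.Additive x v})
    cs.length (cs.length w) (fun v hv => hv.1.length_le)
    (by
      rintro v _ ⟨i, rfl, hi⟩
      rw [hi, length_simple]
      omega)
    (by
      rintro v _ ⟨i, rfl, hi⟩
      exact ⟨_, rfl, hi⟩)
    (by
      rintro v - y hy hvy
      rcases hvy.eq_or_exists_step with h | ⟨z, hz, hzy⟩
      · exact Or.inl h
      · exact Or.inr ⟨z, ⟨hzy.trans hy.1, hzy.additive_of_le hy.2⟩, hz, hzy⟩)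
    (by
      rintro v hv _ hy _ hz ⟨i, rfl, hi⟩ ⟨j, rfl, hj⟩
      by_cases hij : i = j
      · subst hij
        exact ⟨_, hy, WeakLE.refl _, WeakLE.refl _⟩
      obtain ⟨p, q, hpq⟩ := exists_isBraidPair (cs.coxeterMatrix_ne_zero i j)
      refine ⟨v * cs.wordProd (i :: p),
        ⟨cs.weakLE_mul_braidWord hij hpq hi hj hy.1 hz.1, ?_⟩,
        cs.weakLE_braidWord hij hpq hi hj⟩
      exact (hpq.additive cs hij (hy.2.mul_left hi) (hz.2.mul_left hj)).mul_right hv.2)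
    (x := 1) ⟨h1 w, cs.additive_one_right x⟩
  exact ⟨g, hg, fun v hv hv' => hmax v ⟨hv, hv'⟩ (h1 v)⟩

/-- The greatest `v ≤ w` such that `x * v` is length-additive. -/
noncomputable def maxAdd (x w : W) : W := (cs.exists_greatest_weakLE_additive x w).choose

theorem maxAdd_weakLE (x w : W) : cs.WeakLE (cs.maxAdd x w) w :=
  (cs.exists_greatest_weakLE_additive x w).choose_spec.1.1

theorem additive_maxAdd (x w : W) : cs.Additive x (cs.maxAdd x w) :=
  (cs.exists_greatest_weakLE_additive x w).choose_spec.1.2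

theorem weakLE_maxAdd {x w v : W} (h : cs.WeakLE v w) (h' : cs.Additive x v) :
    cs.WeakLE v (cs.maxAdd x w) :=
  (cs.exists_greatest_weakLE_additive x w).choose_spec.2 v h h'

theorem maxAdd_one (w : W) : cs.maxAdd 1 w = w :=
  ((cs.weakLE_maxAdd (WeakLE.refl w) (cs.additive_one_left w)).eq_of_length_le
    (cs.maxAdd_weakLE 1 w).length_le).symm

/-- Absorbing `y` and then `x` keeps as much as absorbing `x * y` at once. The candidate `y * v`
lies below the left side, which therefore has the form `y * (v * b)`; and `v * b` is again
admissible for `x * y`, so maximality of `v` forces equality. -/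
theorem maxAdd_mul {x y : W} (w : W) (hxy : cs.Additive x y) :
    cs.maxAdd x (y * cs.maxAdd y w) = y * cs.maxAdd (x * y) w := by
  set v₀ := cs.maxAdd y w with hv₀
  set v := cs.maxAdd (x * y) w with hv
  have hxyv : cs.Additive (x * y) v := cs.additive_maxAdd _ _
  have hyv : cs.Additive y v := hxyv.right_of_mul hxy
  have hyv₀ : cs.Additive y v₀ := cs.additive_maxAdd _ _
  have hle : cs.WeakLE v v₀ := cs.weakLE_maxAdd (cs.maxAdd_weakLE _ _) hyv
  obtain ⟨r, hr, hvr⟩ := hle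
  have h1 : cs.WeakLE (y * v) (y * v₀) := by
    refine ⟨r, by rw [mul_assoc, hr], ?_⟩
    rw [← hr] at hyv₀
    exact hyv₀.mul_left hvr
  obtain ⟨b, hb, hb'⟩ := cs.weakLE_maxAdd h1 (hxyv.mul_right hxy)
  have hyvb : cs.Additive y (v * b) := hb'.mul_right hyv
  have hψ := cs.additive_maxAdd x (y * v₀)
  obtain ⟨c, hc, hc'⟩ := cs.maxAdd_weakLE x (y * v₀)
  rw [← hb, mul_assoc] at hψ hc hc'
  have hvb₀ : cs.WeakLE (v * b) v₀ := by
    have hc : y * (v * b * c) = y * v₀ := by simpa only [mul_assoc] using hc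
    exact ⟨c, mul_left_cancel hc, hc'.right_of_mul hyvb⟩
  have h2 : cs.WeakLE (v * b) v :=
    cs.weakLE_maxAdd (hvb₀.trans (cs.maxAdd_weakLE _ _)) (hψ.mul_left hyvb)
  have h3 : cs.WeakLE v (v * b) := ⟨b, rfl, hb'.right_of_mul hyv⟩
  rw [← hb, mul_assoc, h2.eq_of_length_le h3.length_le]

end CoxeterSystem

namespace Artin

open CoxeterSystem

variable {B W : Type*} [Group W] {M : CoxeterMatrix B} (cs : CoxeterSystem M W) [Finite W]

theorem braidLift_mul_of_weakLE {v w : W} (h : cs.WeakLE v w) :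
    braidLift cs v * braidLift cs (v⁻¹ * w) = braidLift cs w := by
  obtain ⟨a, rfl, ha⟩ := h
  rw [inv_mul_cancel_left, braidLift_mul cs ha]

/-! ### The head and the tail of an element -/

/-- Left multiplication by the lift of `x`, in terms of pairs (head, tail). -/
noncomputable def headTailAct (x : W) : Function.End (W × BraidMonoid M) := fun P =>
  (x * cs.maxAdd x P.1, braidLift cs ((cs.maxAdd x P.1)⁻¹ * P.1) * P.2)

theorem headTailAct_one : headTailAct cs 1 = 1 := by
  funext P
  simp [headTailAct, maxAdd_one, braidLift_one, Function.End.one_def]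

/-- Heads agree by `maxAdd_mul`. For tails, `x * y` pushes out `a * b`, where `y` pushes out `b` and
then `x` pushes out `a`; this product is length-additive, so its lift splits. -/
theorem headTailAct_mul {x y : W} (h : cs.Additive x y) :
    headTailAct cs (x * y) = headTailAct cs x * headTailAct cs y := by
  funext ⟨w, c⟩
  change headTailAct cs (x * y) (w, c) = headTailAct cs x (headTailAct cs y (w, c))
  simp only [headTailAct]
  rw [maxAdd_mul cs w h]
  refine Prod.ext (mul_assoc _ _ _) ?_
  simp only
  rw [← mul_assoc]
  congr 1
  have hle : cs.WeakLE (cs.maxAdd (x * y) w) (cs.maxAdd y w) :=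
    cs.weakLE_maxAdd (cs.maxAdd_weakLE _ _) ((cs.additive_maxAdd (x * y) w).right_of_mul h)
  obtain ⟨a, ha, ha'⟩ := hle
  obtain ⟨b, hb, hb'⟩ := cs.maxAdd_weakLE y w
  rw [← ha] at hb'
  have e1 : (cs.maxAdd (x * y) w)⁻¹ * w = a * b := by
    rw [inv_mul_eq_iff_eq_mul, ← mul_assoc, ha, hb]
  have e2 : (y * cs.maxAdd (x * y) w)⁻¹ * (y * cs.maxAdd y w) = a := by
    rw [← ha]
    group
  have e3 : (cs.maxAdd y w)⁻¹ * w = b := by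
    rw [inv_mul_eq_iff_eq_mul, hb]
  rw [e1, e2, e3, braidLift_mul cs (hb'.right_of_mul ha')]

theorem prod_map_headTailAct {ω : List B} (h : cs.IsReduced ω) :
    (ω.map fun i => headTailAct cs (cs.simple i)).prod =
      headTailAct cs (cs.wordProd ω) := by
  induction ω with
  | nil =>
    rw [wordProd_nil, headTailAct_one, List.map_nil, List.prod_nil]
  | cons i ω ih =>
    obtain ⟨h1, h2⟩ := h.of_cons
    rw [List.map_cons, List.prod_cons, ih h1, wordProd_cons, headTailAct_mul cs h2]

/-- The action of the presented monoid on pairs (head, tail). -/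
noncomputable def headTailHom : BraidMonoid M →* Function.End (W × BraidMonoid M) :=
  PresentedMonoid.lift (rels := braidRel M) (f := fun i => headTailAct cs (cs.simple i)) (by
    rintro _ _ ⟨i, j, rfl, rfl⟩
    by_cases hij : i = j
    · rw [hij]
    · rw [FreeMonoid.lift_ofList, FreeMonoid.lift_ofList,
        prod_map_headTailAct cs (cs.isReduced_braidWord hij),
        prod_map_headTailAct cs (cs.isReduced_braidWord (Ne.symm hij)), wordProd_braidWord_eq])

theorem headTailHom_singleton (i : B) :
    headTailHom cs (braidMk M [i]) = headTailAct cs (cs.simple i) := rfl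

/-- The element with a given head and tail. -/
noncomputable def ofHeadTail (P : W × BraidMonoid M) : BraidMonoid M := braidLift cs P.1 * P.2

theorem ofHeadTail_headTailAct (x : W) (P : W × BraidMonoid M) :
    ofHeadTail cs (headTailAct cs x P) = braidLift cs x * ofHeadTail cs P := by
  rw [ofHeadTail, ofHeadTail, headTailAct, braidLift_mul cs (cs.additive_maxAdd _ _), mul_assoc,
    ← mul_assoc (braidLift cs (cs.maxAdd x P.1)),
    braidLift_mul_of_weakLE cs (cs.maxAdd_weakLE _ _)]

theorem ofHeadTail_headTailHom (b : BraidMonoid M) (P : W × BraidMonoid M) :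
    ofHeadTail cs (headTailHom cs b P) = b * ofHeadTail cs P := by
  obtain ⟨ω, rfl⟩ := braidMk_surjective b
  induction ω with
  | nil => rw [braidMk_nil, map_one, one_mul]; rfl
  | cons i ω ih =>
    rw [braidMk_cons, map_mul, mul_assoc, ← ih, headTailHom_singleton, ← braidLift_simple cs,
      ← ofHeadTail_headTailAct]
    rfl

theorem ofHeadTail_headTailHom_one (b : BraidMonoid M) :
    ofHeadTail cs (headTailHom cs b (1, 1)) = b := by
  rw [ofHeadTail_headTailHom, ofHeadTail, braidLift_one, mul_one, mul_one]

/-- The action need not be shown injective on pairs: cancelling `x` in `W` recovers the kept part of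
the head, and the kept part times the new tail is the represented element. -/
theorem ofHeadTail_eq_of_headTailAct_eq {x : W} {P Q : W × BraidMonoid M}
    (h : headTailAct cs x P = headTailAct cs x Q) : ofHeadTail cs P = ofHeadTail cs Q := by
  rw [headTailAct, headTailAct, Prod.mk.injEq] at h
  have h1 := mul_left_cancel h.1
  rw [ofHeadTail, ofHeadTail, ← braidLift_mul_of_weakLE cs (cs.maxAdd_weakLE x P.1), mul_assoc,
    h.2, ← mul_assoc, h1, braidLift_mul_of_weakLE cs (cs.maxAdd_weakLE x Q.1)]

/-- The presented monoid is left cancellative. -/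
theorem braidMonoid_mul_left_cancel (cs : CoxeterSystem M W) {a b c : BraidMonoid M} (h : a * b = a * c) : b = c := by
  obtain ⟨ω, rfl⟩ := braidMk_surjective a
  induction ω with
  | nil => simpa [braidMk_nil] using h
  | cons i ω ih =>
    apply ih
    rw [braidMk_cons, mul_assoc, mul_assoc] at h
    have h2 := congrArg (fun z => headTailHom cs z (1, 1)) h
    simp only [map_mul] at h2
    have h3 := ofHeadTail_eq_of_headTailAct_eq cs (x := cs.simple i)
      (P := headTailHom cs (braidMk M ω * b) (1, 1)) (Q := headTailHom cs (braidMk M ω * c) (1, 1))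
      (by simp only [map_mul]; exact h2)
    rwa [ofHeadTail_headTailHom_one, ofHeadTail_headTailHom_one] at h3

theorem isLeftDescent_head (i : B) (c : BraidMonoid M) :
    cs.IsLeftDescent (headTailHom cs (braidMk M [i] * c) (1, 1)).1 i := by
  rw [map_mul]
  change cs.IsLeftDescent (headTailAct cs (cs.simple i) (headTailHom cs c (1, 1))).1 i
  rw [headTailAct, ← additive_simple_simple_mul_iff, simple_mul_simple_cancel_left]
  exact cs.additive_maxAdd _ _

/-- A common left multiple of two generators is a left multiple of their braid word. -/
theorem exists_eq_braidMk_mul (cs : CoxeterSystem M W) {i j : B} (hij : i ≠ j) {p q : List B}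
    (hpq : IsBraidPair M i j p q) {c c' : BraidMonoid M}
    (h : braidMk M [i] * c = braidMk M [j] * c') :
    ∃ d, braidMk M [i] * c = braidMk M (i :: p) * d := by
  have hi := isLeftDescent_head cs i c
  have hj := isLeftDescent_head cs j c'
  rw [← h] at hj
  obtain ⟨v, hv, hav⟩ := hpq.exists_of_isLeftDescent cs hij hi hj
  refine ⟨braidLift cs v * (headTailHom cs (braidMk M [i] * c) (1, 1)).2, ?_⟩
  conv_lhs => rw [← ofHeadTail_headTailHom_one cs (braidMk M [i] * c), ofHeadTail, hv,
    braidLift_mul cs hav, braidLift_wordProd cs (hpq.isReduced cs hij), mul_assoc]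

end Artin

namespace Artin

open CoxeterSystem

variable {B W : Type*} [Group W] {M : CoxeterMatrix B} (cs : CoxeterSystem M W) [Finite W]

/-! ### The longest element -/

theorem length_le_longestElement (w : W) : cs.length w ≤ cs.length (longestElement cs) :=
  (Finite.exists_max cs.length).choose_spec w

/-- Local confluence on all of `W` gives a greatest element, and an element of maximal length below
it must equal it. -/
theorem weakLE_longestElement (w : W) : cs.WeakLE w (longestElement cs) := by
  have h1 : ∀ v, cs.WeakLE 1 v := fun v => ⟨v, one_mul v, cs.additive_one_left v⟩
  obtain ⟨g, -, -, hmax⟩ := exists_greatest_of_locally_confluent (r := cs.WeakLE)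
    (step := fun v v' => ∃ i, v' = v * cs.simple i ∧ cs.Additive v (cs.simple i))
    WeakLE.refl (fun _ _ _ => WeakLE.trans) (E := Set.univ)
    cs.length (cs.length (longestElement cs)) (fun v _ => length_le_longestElement cs v)
    (by
      rintro v _ ⟨i, rfl, hi⟩
      rw [hi, length_simple]
      omega)
    (by
      rintro v _ ⟨i, rfl, hi⟩
      exact ⟨_, rfl, hi⟩)
    (by
      rintro v - y - hvy
      rcases hvy.eq_or_exists_step with h | ⟨z, hz, hzy⟩
      · exact Or.inl h
      · exact Or.inr ⟨z, trivial, hz, hzy⟩)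
    (by
      rintro v - _ - _ - ⟨i, rfl, hi⟩ ⟨j, rfl, hj⟩
      by_cases hij : i = j
      · subst hij
        exact ⟨_, trivial, WeakLE.refl _, WeakLE.refl _⟩
      obtain ⟨p, q, hpq⟩ := exists_isBraidPair (cs.coxeterMatrix_ne_zero i j)
      exact ⟨v * cs.wordProd (i :: p), trivial, cs.weakLE_braidWord hij hpq hi hj⟩)
    (x := 1) trivial
  have h2 := (hmax (longestElement cs) trivial (h1 _)).eq_of_length_le
    (length_le_longestElement cs g)
  rw [h2]
  exact hmax w trivial (h1 w)

theorem longestElement_inv : (longestElement cs)⁻¹ = longestElement cs :=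
  (weakLE_longestElement cs _).eq_of_length_le (by rw [length_inv])

/-- The fundamental element of the presented monoid. -/
noncomputable def braidDelta : BraidMonoid M := braidLift cs (longestElement cs)

theorem exists_mul_eq_braidDelta (i : B) : ∃ t, braidMk M [i] * t = braidDelta cs := by
  refine ⟨braidLift cs ((cs.simple i)⁻¹ * longestElement cs), ?_⟩
  rw [← braidLift_simple cs]
  exact braidLift_mul_of_weakLE cs (weakLE_longestElement cs (cs.simple i))

/-- Writing the longest element as `s i * x` and again as `x * y` forces `y` to have length one.
With `y = s j`, the lifts give `Δ = s i * x = x * s j`, whence the commutation. -/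
theorem exists_simple_conj (i : B) :
    ∃ j, cs.simple j = (longestElement cs)⁻¹ * cs.simple i * longestElement cs ∧
      braidMk M [i] * braidDelta cs = braidDelta cs * braidMk M [j] := by
  obtain ⟨x, hx, hax⟩ := weakLE_longestElement cs (cs.simple i)
  obtain ⟨y, hy, hay⟩ := weakLE_longestElement cs x
  have hly : cs.length y = 1 := by
    have h1 := hax
    have h2 := hay
    rw [CoxeterSystem.Additive, hx, length_simple] at h1
    rw [CoxeterSystem.Additive, hy] at h2
    omega
  obtain ⟨j, rfl⟩ := cs.length_eq_one_iff.1 hly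
  refine ⟨j, ?_, ?_⟩
  · rw [mul_assoc, eq_inv_mul_iff_mul_eq]
    nth_rw 1 [← hx]
    rw [mul_assoc, hy]
  · have e1 : braidDelta cs = braidMk M [i] * braidLift cs x := by
      rw [braidDelta, ← hx, braidLift_mul cs hax, braidLift_simple]
    have e2 : braidDelta cs = braidLift cs x * braidMk M [j] := by
      rw [braidDelta, ← hy, braidLift_mul cs hay, braidLift_simple]
    conv_lhs => rw [e2]
    rw [e1, mul_assoc]

theorem exists_braidMk_conj (i : B) :
    ∃ j, braidMk M [i] * braidDelta cs = braidDelta cs * braidMk M [j] ∧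
      braidMk M [j] * braidDelta cs = braidDelta cs * braidMk M [i] := by
  obtain ⟨j, h1, h2⟩ := exists_simple_conj cs i
  obtain ⟨k, h3, h4⟩ := exists_simple_conj cs j
  refine ⟨j, h2, ?_⟩
  have hk : k = i := by
    apply cs.simple_injective
    rw [h3, h1]
    nth_rw 2 [← longestElement_inv]
    nth_rw 4 [← longestElement_inv]
    group
  rw [h4, hk]

theorem exists_conj (b : BraidMonoid M) :
    ∃ b', b * braidDelta cs = braidDelta cs * b' ∧ b' * braidDelta cs = braidDelta cs * b := by
  obtain ⟨ω, rfl⟩ := braidMk_surjective b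
  induction ω with
  | nil => exact ⟨1, by simp [braidMk_nil]⟩
  | cons i ω ih =>
    obtain ⟨b', h1, h2⟩ := ih
    obtain ⟨j, h3, h4⟩ := exists_braidMk_conj cs i
    refine ⟨braidMk M [j] * b', ?_, ?_⟩
    · rw [braidMk_cons i ω, mul_assoc, h1, ← mul_assoc, h3, mul_assoc]
    · rw [braidMk_cons i ω, mul_assoc, h2, ← mul_assoc, h4, mul_assoc]

theorem exists_mul_eq_braidDelta' (i : B) : ∃ t, t * braidMk M [i] = braidDelta cs := by
  obtain ⟨k, -, hk'⟩ := exists_braidMk_conj cs i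
  obtain ⟨r, hr⟩ := exists_mul_eq_braidDelta cs k
  refine ⟨r, braidMonoid_mul_left_cancel cs (a := braidMk M [k]) ?_⟩
  rw [← mul_assoc, hr, hk']

theorem commute_braidDelta_sq (b : BraidMonoid M) : Commute (braidDelta cs ^ 2) b := by
  obtain ⟨b', h1, h2⟩ := exists_conj cs b
  change braidDelta cs ^ 2 * b = b * braidDelta cs ^ 2
  rw [pow_two, ← mul_assoc b, h1, mul_assoc _ b', h2, mul_assoc]

/-! ### The presented monoid embeds in the Artin group -/

/-- The submonoid of the powers of the square of the fundamental element. -/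
noncomputable abbrev deltaPowers : Submonoid (BraidMonoid M) := Submonoid.powers (braidDelta cs ^ 2)

theorem commute_deltaPowers (s : deltaPowers cs) (b : BraidMonoid M) :
    (s : BraidMonoid M) * b = b * s := by
  obtain ⟨_, n, rfl⟩ := s
  exact (commute_braidDelta_sq cs b).pow_left n

noncomputable instance oreSetDeltaPowers : OreLocalization.OreSet (deltaPowers cs) where
  ore_right_cancel r₁ r₂ s h := ⟨s, by rw [commute_deltaPowers, commute_deltaPowers, h]⟩
  oreNum r _ := r
  oreDenom _ s := s
  ore_eq r s := commute_deltaPowers cs s r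

/-- The localization of the presented monoid at the powers of `Δ²`. -/
abbrev DeltaLocalization : Type _ := OreLocalization (deltaPowers cs) (BraidMonoid M)

/-- The canonical homomorphism into the localization. -/
noncomputable abbrev toDeltaLocalization : BraidMonoid M →* DeltaLocalization cs := OreLocalization.numeratorHom

/-- Equality of fractions with denominator one means equality after left multiplication by a power
of `Δ²`, which cancels. -/
theorem toDeltaLocalization_injective : Function.Injective (toDeltaLocalization cs) := by
  intro a b h
  rw [OreLocalization.numeratorHom_apply, OreLocalization.numeratorHom_apply,
    OreLocalization.oreDiv_eq_iff] at h
  obtain ⟨u, v, h1, h2⟩ := h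
  simp only [OneMemClass.coe_one, mul_one] at h2
  subst h2
  exact (braidMonoid_mul_left_cancel cs h1).symm

theorem isUnit_toDeltaLocalization (i : B) : IsUnit (toDeltaLocalization cs (braidMk M [i])) := by
  obtain ⟨t, ht⟩ := exists_mul_eq_braidDelta cs i
  obtain ⟨t', ht'⟩ := exists_mul_eq_braidDelta' cs i
  have hu : IsUnit (toDeltaLocalization cs (braidDelta cs ^ 2)) :=
    OreLocalization.numerator_isUnit
      (⟨braidDelta cs ^ 2, Submonoid.mem_powers _⟩ : deltaPowers cs)
  have hΔ : IsUnit (toDeltaLocalization cs (braidDelta cs)) := by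
    rw [map_pow] at hu
    exact (isUnit_pow_iff two_ne_zero).1 hu
  obtain ⟨d, hd⟩ := hΔ
  have e1 : toDeltaLocalization cs (braidMk M [i]) * (toDeltaLocalization cs t * ↑d⁻¹) = 1 := by
    rw [← mul_assoc, ← map_mul, ht, ← hd, Units.mul_inv]
  have e2 : (↑d⁻¹ * toDeltaLocalization cs t') * toDeltaLocalization cs (braidMk M [i]) = 1 := by
    rw [mul_assoc, ← map_mul, ht', ← hd, Units.inv_mul]
  refine ⟨⟨_, _, e1, ?_⟩, rfl⟩
  rw [← left_inv_eq_right_inv e2 e1, e2]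

theorem coe_prod_map_unit (ω : List B) :
    (((ω.map fun i => (isUnit_toDeltaLocalization cs i).unit).prod : (DeltaLocalization cs)ˣ) :
      DeltaLocalization cs) = toDeltaLocalization cs (braidMk M ω) := by
  induction ω with
  | nil => rw [braidMk_nil, map_one, List.map_nil, List.prod_nil, Units.val_one]
  | cons i ω ih =>
    rw [List.map_cons, List.prod_cons, Units.val_mul, ih, braidMk_cons i ω, map_mul]
    rfl

/-- The homomorphism from the Artin group to the units of the localization. -/
noncomputable def artinToUnits : ArtinGroup M →* (DeltaLocalization cs)ˣ :=
  PresentedGroup.toGroup (f := fun i => (isUnit_toDeltaLocalization cs i).unit) (by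
    rintro _ ⟨⟨i, j⟩, rfl⟩
    simp only [braidRelator, map_mul, map_inv, mul_inv_eq_one, map_list_prod, List.map_map]
    have h : (FreeGroup.lift fun i => (isUnit_toDeltaLocalization cs i).unit) ∘ FreeGroup.of =
        fun i => (isUnit_toDeltaLocalization cs i).unit := by
      funext k
      simp
    rw [h]
    apply Units.ext
    rw [coe_prod_map_unit, coe_prod_map_unit, braidMk_braidWord])

theorem artinToUnits_word (ω : List B) :
    (artinToUnits cs (word M ω : ArtinGroup M) : DeltaLocalization cs) =
      toDeltaLocalization cs (braidMk M ω) := by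
  induction ω with
  | nil => rw [word_nil, braidMk_nil, map_one, Submonoid.coe_one, map_one, Units.val_one]
  | cons i ω ih =>
    have h1 : word M (i :: ω) = posGen M i * word M ω := by simp [word]
    rw [h1, Submonoid.coe_mul, map_mul, Units.val_mul, ih, braidMk_cons i ω, map_mul]
    congr 1
    change ((artinToUnits cs (PresentedGroup.of i) : (DeltaLocalization cs)ˣ) :
      DeltaLocalization cs) = _
    rw [artinToUnits, PresentedGroup.toGroup.of]
    rfl

/-- The canonical homomorphism from the presented monoid to the positive Artin monoid. -/
def braidToArtin (M : CoxeterMatrix B) : BraidMonoid M →* ArtinMonoid M :=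
  PresentedMonoid.lift (rels := braidRel M) (f := posGen M) (by
    rintro _ _ ⟨i, j, rfl, rfl⟩
    rw [FreeMonoid.lift_ofList, FreeMonoid.lift_ofList]
    apply Subtype.ext
    have h : ∀ ω : List B, ((ω.map (posGen M)).prod : ArtinGroup M) = (ω.map (gen M)).prod := by
      intro ω
      rw [← Submonoid.coe_subtype, map_list_prod, List.map_map]
      rfl
    rw [h, h, prod_map_braidWord_eq])

theorem braidToArtin_braidMk (ω : List B) : braidToArtin M (braidMk M ω) = word M ω := by
  change FreeMonoid.lift (posGen M) (FreeMonoid.ofList ω) = _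
  rw [FreeMonoid.lift_ofList]
  rfl

theorem braidMk_eq_of_word_eq (cs : CoxeterSystem M W) {ω ω' : List B}
    (h : word M ω = word M ω') : braidMk M ω = braidMk M ω' := by
  apply toDeltaLocalization_injective cs
  rw [← artinToUnits_word, ← artinToUnits_word, h]

theorem braidToArtin_injective (cs : CoxeterSystem M W) :
    Function.Injective (braidToArtin M) := by
  intro a b h
  obtain ⟨ω, rfl⟩ := braidMk_surjective a
  obtain ⟨ω', rfl⟩ := braidMk_surjective b
  rw [braidToArtin_braidMk, braidToArtin_braidMk] at h
  exact braidMk_eq_of_word_eq cs h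

end Artin

namespace Artin

open CoxeterSystem

section General

variable {B : Type*} {M : CoxeterMatrix B}

/-! ### Length and divisibility in the positive Artin monoid -/

theorem mul_left_cancel' {a b c : ArtinMonoid M} (h : a * b = a * c) : b = c :=
  Subtype.ext (mul_left_cancel (congrArg Subtype.val h))

theorem mul_right_cancel' {a b c : ArtinMonoid M} (h : b * a = c * a) : b = c :=
  Subtype.ext (mul_right_cancel (congrArg Subtype.val h))

theorem word_cons (i : B) (ω : List B) : word M (i :: ω) = posGen M i * word M ω := by
  simp [word]

/-- The homomorphism from the Artin group to `ℤ` sending all generators to `1`. -/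
def degreeHom (M : CoxeterMatrix B) : ArtinGroup M →* Multiplicative ℤ :=
  PresentedGroup.toGroup (f := fun _ => Multiplicative.ofAdd 1) (by
    rintro _ ⟨⟨i, j⟩, rfl⟩
    simp only [braidRelator, map_mul, map_inv, mul_inv_eq_one, map_list_prod, List.map_map]
    have h : (FreeGroup.lift fun _ : B => Multiplicative.ofAdd (1 : ℤ)) ∘ FreeGroup.of =
        fun _ => Multiplicative.ofAdd 1 := by
      funext k
      simp
    rw [h, List.map_const', List.map_const', List.prod_replicate, List.prod_replicate,
      length_alternatingWord, length_alternatingWord, M.symmetric])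

theorem degreeHom_word (ω : List B) :
    degreeHom M (word M ω : ArtinGroup M) = Multiplicative.ofAdd (ω.length : ℤ) := by
  induction ω with
  | nil => rw [word_nil, Submonoid.coe_one, map_one]; rfl
  | cons i ω ih =>
    have h : degreeHom M (posGen M i : ArtinGroup M) = Multiplicative.ofAdd 1 := by
      change degreeHom M (PresentedGroup.of i) = _
      rw [degreeHom, PresentedGroup.toGroup.of]
    rw [word_cons, Submonoid.coe_mul, map_mul, ih, h, ← ofAdd_add, List.length_cons]
    push_cast
    rw [add_comm]

/-- All expressions of an element have the same length, since `degreeHom` reads it off. Hence the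
length condition in the weak order is automatic. -/
theorem length_word (ω : List B) : length (word M ω) = ω.length := by
  obtain ⟨ω', h1, h2⟩ := exists_word_length_eq (word M ω)
  have h := congrArg (fun x : ArtinMonoid M => degreeHom M (x : ArtinGroup M)) h2
  simp only [degreeHom_word] at h
  have h3 : (ω'.length : ℤ) = ω.length := Multiplicative.ofAdd.injective h
  omega

theorem length_mul (u v : ArtinMonoid M) : length (u * v) = length u + length v := by
  obtain ⟨ω, rfl⟩ := word_surjective M u
  obtain ⟨ω', rfl⟩ := word_surjective M v
  rw [← word_append, length_word, length_word, length_word, List.length_append]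

theorem length_posGen (i : B) : length (posGen M i) = 1 := by
  have h := length_word (M := M) [i]
  simpa [word] using h

theorem length_pow (u : ArtinMonoid M) (m : ℕ) : length (u ^ m) = m * length u := by
  induction m with
  | zero => rw [pow_zero, length_one, zero_mul]
  | succ m ih => rw [pow_succ, length_mul, ih, add_mul, one_mul]

theorem le_iff_exists_mul {u w : ArtinMonoid M} : u ≤ w ↔ ∃ v, u * v = w :=
  ⟨fun ⟨v, h, _⟩ => ⟨v, h⟩, fun ⟨v, h⟩ => ⟨v, h, by rw [← h, length_mul]⟩⟩

theorem one_le_artinMonoid (w : ArtinMonoid M) : 1 ≤ w := le_iff_exists_mul.2 ⟨w, one_mul w⟩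

theorem length_mono {u w : ArtinMonoid M} (h : u ≤ w) : length u ≤ length w := by
  obtain ⟨v, rfl⟩ := le_iff_exists_mul.1 h
  rw [length_mul]
  omega

theorem eq_one_or_exists_posGen_mul (v : ArtinMonoid M) : v = 1 ∨ ∃ i v', v = posGen M i * v' := by
  obtain ⟨ω, rfl⟩ := word_surjective M v
  match ω with
  | [] => exact Or.inl rfl
  | i :: ω => exact Or.inr ⟨i, word M ω, word_cons i ω⟩

theorem eq_or_exists_mul_posGen_le {u w : ArtinMonoid M} (h : u ≤ w) :
    u = w ∨ ∃ i, u * posGen M i ≤ w := by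
  obtain ⟨v, rfl⟩ := le_iff_exists_mul.1 h
  rcases eq_one_or_exists_posGen_mul v with rfl | ⟨i, v', rfl⟩
  · exact Or.inl (mul_one u).symm
  · exact Or.inr ⟨i, le_iff_exists_mul.2 ⟨v', mul_assoc _ _ _⟩⟩

theorem finite_Iic [Finite B] (w : ArtinMonoid M) : (Set.Iic w).Finite := by
  refine ((List.finite_length_le B (length w)).image (word M)).subset fun u hu => ?_
  obtain ⟨ω, rfl⟩ := word_surjective M u
  refine ⟨ω, ?_, rfl⟩
  rw [Set.mem_ofPred_eq, ← length_word (M := M)]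
  exact length_mono hu

/-! ### The reversal -/

theorem rev_mul (u v : ArtinMonoid M) : rev (u * v) = rev v * rev u := by
  obtain ⟨ω, rfl⟩ := word_surjective M u
  obtain ⟨ω', rfl⟩ := word_surjective M v
  rw [← word_append, rev_word, rev_word, rev_word, List.reverse_append, word_append]

theorem rev_rev (u : ArtinMonoid M) : rev (rev u) = u := by
  obtain ⟨ω, rfl⟩ := word_surjective M u
  rw [rev_word, rev_word, List.reverse_reverse]

theorem rev_one : rev (1 : ArtinMonoid M) = 1 := by
  rw [← word_nil, rev_word, List.reverse_nil]

theorem length_rev (u : ArtinMonoid M) : length (rev u) = length u := by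
  obtain ⟨ω, rfl⟩ := word_surjective M u
  rw [rev_word, length_word, length_word, List.length_reverse]

theorem rev_pow {u : ArtinMonoid M} (h : rev u = u) (m : ℕ) : rev (u ^ m) = u ^ m := by
  induction m with
  | zero => rw [pow_zero, rev_one]
  | succ m ih => rw [pow_succ, rev_mul, ih, h, ← pow_succ', pow_succ]

theorem braidToArtin_surjective : Function.Surjective (braidToArtin M) := by
  intro u
  obtain ⟨ω, rfl⟩ := word_surjective M u
  exact ⟨braidMk M ω, braidToArtin_braidMk ω⟩

end General

variable {B W : Type*} [Group W] {M : CoxeterMatrix B} (cs : CoxeterSystem M W) [Finite W]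

/-! ### Greatest common divisors -/

theorem exists_eq_word_mul (cs : CoxeterSystem M W) {i j : B} (hij : i ≠ j) {p q : List B}
    (hpq : IsBraidPair M i j p q) {c c' : ArtinMonoid M} (h : posGen M i * c = posGen M j * c') :
    ∃ d, posGen M i * c = word M (i :: p) * d := by
  obtain ⟨b, rfl⟩ := braidToArtin_surjective c
  obtain ⟨b', rfl⟩ := braidToArtin_surjective c'
  have hg : ∀ k, posGen M k = braidToArtin M (braidMk M [k]) := fun k => by
    rw [braidToArtin_braidMk]
    simp [word]
  rw [hg, hg, ← map_mul, ← map_mul] at h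
  obtain ⟨d, hd⟩ := exists_eq_braidMk_mul cs hij hpq (braidToArtin_injective cs h)
  refine ⟨braidToArtin M d, ?_⟩
  rw [hg, ← map_mul, hd, map_mul, braidToArtin_braidMk]

theorem word_eq_of_isBraidPair {i j : B} {p q : List B} (h : IsBraidPair M i j p q) :
    word M (i :: p) = word M (j :: q) := by
  rw [← braidToArtin_braidMk, ← braidToArtin_braidMk, braidMk_eq_of_isBraidPair h]

theorem mul_word_le (cs : CoxeterSystem M W) {i j : B} (hij : i ≠ j) {p q : List B}
    (hpq : IsBraidPair M i j p q) {x a : ArtinMonoid M} (hi : x * posGen M i ≤ a)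
    (hj : x * posGen M j ≤ a) : x * word M (i :: p) ≤ a := by
  obtain ⟨c, rfl⟩ := le_iff_exists_mul.1 hi
  obtain ⟨c', hc'⟩ := le_iff_exists_mul.1 hj
  rw [mul_assoc, mul_assoc] at hc'
  obtain ⟨d, hd⟩ := exists_eq_word_mul cs hij hpq (mul_left_cancel' hc').symm
  exact le_iff_exists_mul.2 ⟨d, by rw [mul_assoc, ← hd, mul_assoc]⟩

theorem mul_posGen_le_mul_word (i : B) (p : List B) (x : ArtinMonoid M) :
    x * posGen M i ≤ x * word M (i :: p) :=
  le_iff_exists_mul.2 ⟨word M p, by rw [mul_assoc, word_cons]⟩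

/-- Local confluence for common left divisors: if `x * s i` and `x * s j` divide `a` and `b`, so
does `x` times the braid word, by `mul_word_le`. -/
theorem exists_isGLB (cs : CoxeterSystem M W) (a b : ArtinMonoid M) : ∃ g, IsGLB {a, b} g := by
  obtain ⟨g, hg, -, hmax⟩ := exists_greatest_of_locally_confluent
    (r := fun x y : ArtinMonoid M => x ≤ y)
    (step := fun x y => ∃ i, y = x * posGen M i)
    (fun x => le_refl x) (fun _ _ _ => le_trans) (E := {x | x ≤ a ∧ x ≤ b})
    length (length a) (fun x hx => length_mono hx.1)
    (by
      rintro x _ ⟨i, rfl⟩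
      rw [length_mul, length_posGen]
      omega)
    (by
      rintro x _ ⟨i, rfl⟩
      exact le_iff_exists_mul.2 ⟨_, rfl⟩)
    (by
      rintro x - y hy hxy
      rcases eq_or_exists_mul_posGen_le hxy with h | ⟨i, hi⟩
      · exact Or.inl h
      · exact Or.inr ⟨_, ⟨hi.trans hy.1, hi.trans hy.2⟩, ⟨i, rfl⟩, hi⟩)
    (by
      rintro x - _ hy _ hz ⟨i, rfl⟩ ⟨j, rfl⟩
      by_cases hij : i = j
      · subst hij
        exact ⟨_, hy, le_refl _, le_refl _⟩
      obtain ⟨p, q, hpq⟩ := exists_isBraidPair (cs.coxeterMatrix_ne_zero i j)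
      refine ⟨x * word M (i :: p), ⟨mul_word_le cs hij hpq hy.1 hz.1,
        mul_word_le cs hij hpq hy.2 hz.2⟩, mul_posGen_le_mul_word i p x, ?_⟩
      rw [word_eq_of_isBraidPair hpq]
      exact mul_posGen_le_mul_word j q x)
    (x := 1) ⟨one_le_artinMonoid a, one_le_artinMonoid b⟩
  refine ⟨g, ?_, ?_⟩
  · rintro x (rfl | rfl)
    · exact hg.1
    · exact hg.2
  · intro x hx
    exact hmax x ⟨hx (Or.inl rfl), hx (Or.inr rfl)⟩ (one_le_artinMonoid x)

/-! ### The fundamental element -/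

theorem braidToArtin_braidDelta : braidToArtin M (braidDelta cs) = fundamental cs :=
  braidToArtin_braidMk _

/-- The reverse of a reduced word of the longest element is a reduced word of its inverse, which is
itself; Matsumoto's theorem identifies the two. -/
theorem rev_fundamental : rev (fundamental cs) = fundamental cs := by
  have hs := (cs.exists_isReduced (longestElement cs)).choose_spec
  rw [fundamental, posLift, rev_word, ← braidToArtin_braidMk, ← braidToArtin_braidMk]
  refine congrArg _ (braidMk_eq_of_isReduced cs hs.1.reverse hs.1 ?_)
  rw [wordProd_reverse, ← hs.2, longestElement_inv]

theorem length_fundamental : length (fundamental cs) = cs.length (longestElement cs) := by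
  have hs := (cs.exists_isReduced (longestElement cs)).choose_spec
  rw [fundamental, posLift, length_word, ← hs.1, ← hs.2]

theorem length_fundamental_pow (m : ℕ) :
    length (fundamental cs ^ m) = m * cs.length (longestElement cs) := by
  rw [length_pow, length_fundamental]

theorem exists_conj_fundamental (b : ArtinMonoid M) :
    ∃ b', b * fundamental cs = fundamental cs * b' ∧ b' * fundamental cs = fundamental cs * b := by
  obtain ⟨b, rfl⟩ := braidToArtin_surjective b
  obtain ⟨b', h1, h2⟩ := exists_conj cs b
  refine ⟨braidToArtin M b', ?_, ?_⟩
  · rw [← braidToArtin_braidDelta, ← map_mul, h1, map_mul]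
  · rw [← braidToArtin_braidDelta, ← map_mul, h2, map_mul]

theorem exists_conj_fundamental_pow (m : ℕ) (b : ArtinMonoid M) :
    ∃ b', b * fundamental cs ^ m = fundamental cs ^ m * b' ∧
      b' * fundamental cs ^ m = fundamental cs ^ m * b := by
  induction m with
  | zero => exact ⟨b, by simp⟩
  | succ m ih =>
    obtain ⟨b', h1, h2⟩ := ih
    obtain ⟨b'', h3, h4⟩ := exists_conj_fundamental cs b'
    refine ⟨b'', ?_, ?_⟩
    · rw [pow_succ, ← mul_assoc, h1, mul_assoc, h3, mul_assoc]
    · rw [pow_succ', ← mul_assoc, h4, mul_assoc, h2, mul_assoc]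

/-- Left divisors of the power are right divisors: the conjugate of the right complement `v` by the
power is a left complement. -/
theorem exists_mul_eq_of_mul_eq {m : ℕ} {w v : ArtinMonoid M} (h : w * v = fundamental cs ^ m) :
    ∃ u, u * w = fundamental cs ^ m := by
  obtain ⟨u, -, hu⟩ := exists_conj_fundamental_pow cs m v
  refine ⟨u, mul_right_cancel' (a := v) ?_⟩
  rw [mul_assoc, h, hu]

theorem exists_mul_eq_of_mul_eq' {m : ℕ} {w u : ArtinMonoid M} (h : u * w = fundamental cs ^ m) :
    ∃ v, w * v = fundamental cs ^ m := by
  obtain ⟨v, hv, -⟩ := exists_conj_fundamental_pow cs m u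
  refine ⟨v, mul_left_cancel' (a := u) ?_⟩
  rw [← mul_assoc, h, hv]

/-! ### Duality in the `m`-weak order -/

section Duality

variable {cs} {m : ℕ}

theorem exists_complement (w : MWeak cs m) :
    ∃ u : ArtinMonoid M, u * (w : ArtinMonoid M) = fundamental cs ^ m := by
  obtain ⟨v, hv⟩ := le_iff_exists_mul.1 w.2.2
  exact exists_mul_eq_of_mul_eq cs hv

/-- The positive element `w∘ ^ m * w⁻¹`. -/
noncomputable def complement (w : MWeak cs m) : ArtinMonoid M := (exists_complement w).choose

theorem complement_mul (w : MWeak cs m) : complement w * w = fundamental cs ^ m :=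
  (exists_complement w).choose_spec

theorem coe_complement (w : MWeak cs m) :
    (complement w : ArtinGroup M) =
      (fundamental cs : ArtinGroup M) ^ m * ((w : ArtinMonoid M) : ArtinGroup M)⁻¹ := by
  rw [eq_mul_inv_iff_mul_eq, ← Submonoid.coe_mul, complement_mul, SubmonoidClass.coe_pow]

theorem rev_mul_rev_complement (w : MWeak cs m) :
    rev (w : ArtinMonoid M) * rev (complement w) = fundamental cs ^ m := by
  rw [← rev_mul, complement_mul, rev_pow (rev_fundamental cs)]

/-- The duality `w ↦ rev (w∘ ^ m * w⁻¹)` of the `m`-weak order. -/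
noncomputable def dual (w : MWeak cs m) : MWeak cs m :=
  ⟨rev (complement w), one_le_artinMonoid _,
    le_iff_exists_mul.2 (exists_mul_eq_of_mul_eq' cs (rev_mul_rev_complement w))⟩

theorem dual_dual (w : MWeak cs m) : dual (dual w) = w := by
  apply Subtype.ext
  have h : complement (dual w) = rev (w : ArtinMonoid M) :=
    mul_right_cancel' ((complement_mul (dual w)).trans (rev_mul_rev_complement w).symm)
  change rev (complement (dual w)) = _
  rw [h, rev_rev]

theorem dual_le_dual {w w' : MWeak cs m} (h : w ≤ w') : dual w' ≤ dual w := by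
  obtain ⟨v, hv⟩ := le_iff_exists_mul.1 (show (w : ArtinMonoid M) ≤ w' from h)
  obtain ⟨x, -, hx⟩ := exists_conj_fundamental_pow cs m v
  -- Enlarging `w` by `v` on the right removes from the complement the left factor `x`, a conjugate
  -- of `v`; reversal makes it a right factor, as divisibility requires.
  have key : x * complement w' = complement w := by
    apply mul_right_cancel' (a := (w' : ArtinMonoid M))
    rw [mul_assoc, complement_mul, hx, ← hv, ← mul_assoc, complement_mul]
  change rev (complement w') ≤ rev (complement w)
  rw [← key, rev_mul]
  exact le_iff_exists_mul.2 ⟨_, rfl⟩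

theorem le_dual_iff {w w' : MWeak cs m} : w ≤ dual w' ↔ w' ≤ dual w := by
  constructor <;> intro h
  · simpa only [dual_dual] using dual_le_dual h
  · simpa only [dual_dual] using dual_le_dual h

theorem dual_le_iff {w w' : MWeak cs m} : dual w ≤ w' ↔ dual w' ≤ w := by
  constructor <;> intro h
  · simpa only [dual_dual] using dual_le_dual h
  · simpa only [dual_dual] using dual_le_dual h

theorem length_dual (w : MWeak cs m) :
    length (dual w : ArtinMonoid M) + length (w : ArtinMonoid M) =
      m * cs.length (longestElement cs) := by
  change length (rev (complement w)) + _ = _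
  rw [length_rev, ← length_mul, complement_mul, length_fundamental_pow]

/-- The duality as an equivalence. -/
noncomputable def dualEquiv (cs : CoxeterSystem M W) (m : ℕ) : MWeak cs m ≃ MWeak cs m :=
  Function.Involutive.toPerm dual dual_dual

/-- The duality as an order isomorphism onto the order dual. -/
noncomputable def dualOrderIso (cs : CoxeterSystem M W) (m : ℕ) :
    MWeak cs m ≃o (MWeak cs m)ᵒᵈ where
  toEquiv := (dualEquiv cs m).trans OrderDual.toDual
  map_rel_iff' {w w'} := by
    change dual w' ≤ dual w ↔ w ≤ w'
    rw [le_dual_iff, dual_dual]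

/-! ### The `m`-weak order is a finite graded lattice -/

theorem MWeak.exists_isGLB (u v : MWeak cs m) : ∃ y, IsGLB {u, v} y := by
  obtain ⟨g, hg1, hg2⟩ := Artin.exists_isGLB cs (u : ArtinMonoid M) v
  refine ⟨⟨g, one_le_artinMonoid g, (hg1 (Or.inl rfl)).trans u.2.2⟩, ?_, ?_⟩
  · rintro x (rfl | rfl)
    · exact hg1 (Or.inl rfl)
    · exact hg1 (Or.inr rfl)
  · intro x hx
    refine hg2 ?_
    rintro _ (rfl | rfl)
    · exact hx (Or.inl rfl)
    · exact hx (Or.inr rfl)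

theorem MWeak.exists_isLUB (u v : MWeak cs m) : ∃ x, IsLUB {u, v} x := by
  obtain ⟨y, hy1, hy2⟩ := MWeak.exists_isGLB (dual u) (dual v)
  refine ⟨dual y, ?_, ?_⟩
  · rintro x (rfl | rfl)
    · exact le_dual_iff.1 (hy1 (Or.inl rfl))
    · exact le_dual_iff.1 (hy1 (Or.inr rfl))
  · intro x hx
    rw [dual_le_iff]
    refine hy2 ?_
    rintro _ (rfl | rfl)
    · exact dual_le_dual (hx (Or.inl rfl))
    · exact dual_le_dual (hx (Or.inr rfl))

theorem MWeak.finite (cs : CoxeterSystem M W) (m : ℕ) : Finite (MWeak cs m) := by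
  have := cs.finite_index
  exact ((finite_Iic (fundamental cs ^ m)).subset fun _ h => h.2).to_subtype

theorem MWeak.length_strictMono :
    StrictMono fun w : MWeak cs m => length (w : ArtinMonoid M) := by
  intro u w h
  obtain ⟨v, hv⟩ := le_iff_exists_mul.1 (show (u : ArtinMonoid M) ≤ w from h.le)
  have hne : length v ≠ 0 := by
    intro h0
    rw [eq_one_of_length_eq_zero h0, mul_one] at hv
    exact h.ne (Subtype.ext hv)
  simp only [← hv, length_mul]
  omega

/-- A cover is multiplication by a single generator, because the first generator of the quotient
already gives an element of the interval strictly above `u`. -/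
theorem MWeak.length_covBy {u w : MWeak cs m} (h : u ⋖ w) :
    length (u : ArtinMonoid M) ⋖ length (w : ArtinMonoid M) := by
  rcases eq_or_exists_mul_posGen_le (show (u : ArtinMonoid M) ≤ w from h.1.le) with he | ⟨i, hi⟩
  · exact absurd (Subtype.ext he) h.1.ne
  · set z : MWeak cs m := ⟨u * posGen M i, one_le_artinMonoid _, hi.trans w.2.2⟩ with hz
    have hlen : length (z : ArtinMonoid M) = length (u : ArtinMonoid M) + 1 := by
      rw [hz, length_mul, length_posGen]
    have huz : u < z := by
      refine lt_of_le_of_ne (le_iff_exists_mul.2 ⟨posGen M i, rfl⟩ :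
        (u : ArtinMonoid M) ≤ u * posGen M i) ?_
      intro he
      rw [← he] at hlen
      omega
    have hzw : z = w := by
      by_contra hne
      exact h.2 huz (lt_of_le_of_ne (show z ≤ w from hi) hne)
    rw [← hzw, hlen]
    exact Order.covBy_add_one _

/-- The grading of the `m`-weak order by length. -/
noncomputable abbrev MWeak.gradeMinOrder (cs : CoxeterSystem M W) (m : ℕ) :
    GradeMinOrder ℕ (MWeak cs m) where
  grade w := length (w : ArtinMonoid M)
  grade_strictMono := MWeak.length_strictMono
  covBy_grade _ _ h := MWeak.length_covBy h
  isMin_grade {w} hw := by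
    have h1 : (1 : ArtinMonoid M) ≤ fundamental cs ^ m := one_le_artinMonoid _
    have h2 : w ≤ ⟨1, le_refl _, h1⟩ := hw (show (1 : ArtinMonoid M) ≤ w from w.2.1)
    have h3 := length_mono (show (w : ArtinMonoid M) ≤ 1 from h2)
    rw [length_one] at h3
    rw [Nat.le_zero.1 h3]
    exact isMin_bot

theorem MWeak.card_length_eq (cs : CoxeterSystem M W) (m : ℕ) {k l : ℕ}
    (h : k + l = m * cs.length (longestElement cs)) :
    Nat.card {w : MWeak cs m // length (w : ArtinMonoid M) = k} =
      Nat.card {w : MWeak cs m // length (w : ArtinMonoid M) = l} := by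
  refine Nat.card_congr ((dualEquiv cs m).subtypeEquiv fun w => ?_)
  have := length_dual w
  change _ ↔ length (dual w : ArtinMonoid M) = l
  omega

end Duality

end Artin

theorem mainTheorem9 {B W : Type*} [Group W] [Finite W] {M : CoxeterMatrix B}
    (cs : CoxeterSystem M W) (m : ℕ) :
    -- the `m`-weak order is a finite lattice
    Finite (Artin.MWeak cs m) ∧
    (∀ u v : Artin.MWeak cs m, (∃ x, IsLUB {u, v} x) ∧ (∃ y, IsGLB {u, v} y)) ∧
    -- it is graded by length, of total rank `m * ℓ(w∘)`
    (∃ g : GradeMinOrder ℕ (Artin.MWeak cs m),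
      ∀ w : Artin.MWeak cs m, g.grade w = Artin.length (w : Artin.ArtinMonoid M)) ∧
    Artin.length (Artin.fundamental cs ^ m) = m * cs.length (Artin.longestElement cs) ∧
    -- it is rank-symmetric
    (∀ k l : ℕ, k + l = m * cs.length (Artin.longestElement cs) →
      Nat.card {w : Artin.MWeak cs m // Artin.length (w : Artin.ArtinMonoid M) = k} =
        Nat.card {w : Artin.MWeak cs m // Artin.length (w : Artin.ArtinMonoid M) = l}) ∧
    -- it is self-dual via `w ↦ rev (w∘ ^ m * w⁻¹)`, where `w∘ ^ m * w⁻¹` is a positive element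
    (∃ e : Artin.MWeak cs m ≃o (Artin.MWeak cs m)ᵒᵈ, ∀ w : Artin.MWeak cs m,
      ∃ u : Artin.ArtinMonoid M,
        (u : Artin.ArtinGroup M) =
          (Artin.fundamental cs : Artin.ArtinGroup M) ^ m *
            ((w : Artin.ArtinMonoid M) : Artin.ArtinGroup M)⁻¹ ∧
        ((OrderDual.ofDual (e w) : Artin.MWeak cs m) : Artin.ArtinMonoid M) = Artin.rev u) := by

  refine ⟨Artin.MWeak.finite cs m,
    fun u v => ⟨Artin.MWeak.exists_isLUB u v, Artin.MWeak.exists_isGLB u v⟩,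
    ⟨Artin.MWeak.gradeMinOrder cs m, fun _ => rfl⟩, Artin.length_fundamental_pow cs m,
    fun k l h => Artin.MWeak.card_length_eq cs m h, Artin.dualOrderIso cs m, fun w => ?_⟩
  exact ⟨Artin.complement w, Artin.coe_complement w, rfl⟩
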